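/- Let $m\ge 0$ be an integer, let $\mathbf k=(k_1,\dots,k_r)$ with $r\ge 1$ be a tuple of positive integers, and let $\alpha\in\mathbb C$ with $\Re(\alpha)<1$. Notation. For a tuple $\mathbf l=(l_1,\dots,l_s)$ of positive integers, $n\ge 0$ and $a\in\mathbb C\setminus\{0,-1,-2,\dots\}$ put $$\zeta_n(\mathbf l;a)=\sum_{n\ge n_1>\cdots>n_s>0}\ \prod_{i=1}^s\frac1{(n_i+a-1)^{l_i}},\qquad \zeta^\star_n(\mathbf l;a)=\sum_{n\ge n_1\ge\cdots\ge n_s>0}\ \prod_{i=1}^s\frac1{(n_i+a-1)^{l_i}},$$ both equal to $1$ for the empty tuple; $\zeta_n(\mathbf l)=\zeta_n(\mathbf l;1)$, and $\zeta(\mathbf l;a)=\lim_{n\to\infty}\zeta_n(\mathbf l;a)$ if $l_1>1$. Write $\{1\}_m$ for $m$ repetitions of $1$, $|\mathbf l|=l_1+\cdots+l_s$, $\overleftarrow{\mathbf l}=(l_s,\dots,l_1)$, $\mathbf l_+=(l_1+1,l_2,\dots,l_s)$. The Hoffman dual $\mathbf l^\vee$ is the tuple of positive integers of the same sum $|\mathbf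 l|$ whose proper partial sums form the complement in $\{1,\dots,|\mathbf l|-1\}$ of the set of proper partial sums $l_1,\ l_1+l_2,\ \dots,\ l_1+\cdots+l_{s-1}$ of $\mathbf l$. For $\mathbf j=(j_1,\dots,j_s)\in\mathbb Z_{\ge0}^s$ put $B(\mathbf l;\mathbf j)=\prod_{i=1}^s\binom{l_i+j_i-1}{j_i}$, and let $\mathbf l+\mathbf j$ be the entrywise sum. Finally $\binom ab=\frac{\Gamma(a+1)}{\Gamma(b+1)\Gamma(a-b+1)}$ for complex $a,b$. Put $\mathbf K=(\overleftarrow{\mathbf k}^{\,\vee})_+$, which has $d=|\mathbf k|+1-r$ entries. Then the series and all the limits below converge, and $$\sum_{n=1}^\infty\frac{\zeta_{n-1}(k_2,\dots,k_r)\,\zeta^\star_n(\{1\}_m;1-\alpha)}{n^{k_1+1}\binom{n-\alpha}{n}}=\sum_{\mathbf j\in\mathbb Z_{\ge0}^{d},\ j_1+\cdots+j_d=m}B(\mathbf K;\mathbf j)\,\zeta(\mathbf K+\mathbf j;1-\alpha).$$ -/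

import Mathlib

open Filter Topology

/-- The multiple harmonic sum
`ζ_n(k₁,…,k_r) = ∑_{n ≥ n₁ > ⋯ > n_r > 0} 1 / (n₁^{k₁} ⋯ n_r^{k_r})`,
written as an iterated sum over `n₁`, then `n₂ ≤ n₁ - 1`, and so on; `ζ_n(∅) = 1`. -/
def mhs : ℕ → List ℕ → ℚ
  | _, [] => 1
  | n, k :: ks => ∑ m ∈ Finset.Icc 1 n, 1 / (m : ℚ) ^ k * mhs (m - 1) ks

/-- The Hurwitz-type multiple harmonic sum
`ζ_n(k₁,…,k_r; a) = ∑_{n ≥ n₁ > ⋯ > n_r > 0} ∏ᵢ 1 / (nᵢ + a - 1)^{kᵢ}`; `ζ_n(∅; a) = 1`. -/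
noncomputable def hurwitzMHS : ℕ → List ℕ → ℂ → ℂ
  | _, [], _ => 1
  | n, k :: ks, a =>
      ∑ m ∈ Finset.Icc 1 n, 1 / ((m : ℂ) + a - 1) ^ k * hurwitzMHS (m - 1) ks a

/-- The Hurwitz-type multiple harmonic star sum
`ζ⋆_n(k₁,…,k_r; a) = ∑_{n ≥ n₁ ≥ ⋯ ≥ n_r > 0} ∏ᵢ 1 / (nᵢ + a - 1)^{kᵢ}`; `ζ⋆_n(∅; a) = 1`. -/
noncomputable def hurwitzMHSS : ℕ → List ℕ → ℂ → ℂ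
  | _, [], _ => 1
  | n, k :: ks, a =>
      ∑ m ∈ Finset.Icc 1 n, 1 / ((m : ℂ) + a - 1) ^ k * hurwitzMHSS m ks a

/-- The Hurwitz-type multiple zeta value `ζ(k; a) = lim_{n → ∞} ζ_n(k; a)`. -/
noncomputable def hurwitzMZV (k : List ℕ) (a : ℂ) : ℂ :=
  limUnder atTop (fun n : ℕ => hurwitzMHS n k a)

/-- The general binomial coefficient `Γ(a + 1) / (Γ(b + 1) Γ(a - b + 1))`. -/
noncomputable def gammaBinom (a b : ℂ) : ℂ :=
  Complex.Gamma (a + 1) / (Complex.Gamma (b + 1) * Complex.Gamma (a - b + 1))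

/-- `k₊ = (k₁ + 1, k₂, …, k_r)`. -/
def plusFirst : List ℕ → List ℕ
  | [] => []
  | k :: ks => (k + 1) :: ks

/-- The Hoffman dual of a composition: writing `k = (1 + ⋯ + 1, …, 1 + ⋯ + 1)` with `kᵢ` ones in
the `i`-th entry, swap commas and plus signs. An entry `k` becomes `k` entries `1`, and the comma
behind it becomes a plus sign, which merges the last of these `1`s with the first entry of the dual
of what follows. -/
def hoffmanDual : List ℕ → List ℕ
  | [] => []
  | [k] => List.replicate k 1
  | k :: l :: ks => List.replicate (k - 1) 1 ++ plusFirst (hoffmanDual (l :: ks))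

/-- `B(k; j) = ∏ᵢ binom(kᵢ + jᵢ - 1, jᵢ)` for lists `k`, `j` of the same length. -/
def prodBinom (k j : List ℕ) : ℕ :=
  (List.zipWith (fun a b => (a + b - 1).choose b) k j).prod

/-- Entrywise sum `k + j` of lists `k`, `j` of the same length. -/
def addEntries (k j : List ℕ) : List ℕ :=
  List.zipWith (fun a b => a + b) k j

theorem plusFirst_length (k : List ℕ) : (plusFirst k).length = k.length := by
  cases k <;> simp [plusFirst]

/-- The dual has depth `|k| + 1 - dep(k)`. -/
theorem hoffmanDual_length : ∀ k : List ℕ, k ≠ [] → (∀ i ∈ k, 1 ≤ i) →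
    (hoffmanDual k).length + k.length = k.sum + 1
  | [], h, _ => absurd rfl h
  | [k], _, _ => by simp [hoffmanDual]
  | k :: l :: ks, _, hp => by
      have ih := hoffmanDual_length (l :: ks) (by simp) (fun i hi => hp i (by simp_all))
      have hk := hp k (by simp)
      simp only [hoffmanDual, List.length_append, List.length_replicate, plusFirst_length,
        List.length_cons, List.sum_cons] at ih ⊢
      omega

theorem hoffmanDual_ne_nil (k : List ℕ) (h : k ≠ []) (hp : ∀ i ∈ k, 1 ≤ i) :
    hoffmanDual k ≠ [] := by
  intro h0
  have h1 := hoffmanDual_length k h hp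
  have h2 : k.length ≤ k.sum := by
    clear h h0 h1
    induction k with
    | nil => simp
    | cons a l ih =>
      have := ih (fun i hi => hp i (by simp [hi]))
      have := hp a (by simp)
      simp only [List.length_cons, List.sum_cons]
      omega
  simp [h0] at h1
  omega

/-- All entries of the dual are positive. -/
theorem hoffmanDual_pos : ∀ k : List ℕ, ∀ i ∈ hoffmanDual k, 1 ≤ i
  | [], i, hi => by simp [hoffmanDual] at hi
  | [k], i, hi => by
      rw [hoffmanDual] at hi
      exact (List.eq_of_mem_replicate hi).ge
  | k :: l :: ks, i, hi => by
      have ih := hoffmanDual_pos (l :: ks)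
      rw [hoffmanDual, List.mem_append] at hi
      rcases hi with hi | hi
      · exact (List.eq_of_mem_replicate hi).ge
      · generalize hoffmanDual (l :: ks) = D at *
        cases D with
        | nil => simp [plusFirst] at hi
        | cons a D =>
          rw [plusFirst, List.mem_cons] at hi
          rcases hi with hi | hi
          · omega
          · exact ih i (by simp [hi])

theorem plusFirst_sum (k : List ℕ) (h : k ≠ []) : (plusFirst k).sum = k.sum + 1 := by
  cases k with
  | nil => exact absurd rfl h
  | cons a l => simp [plusFirst]; omega

/-- The dual has the same weight. -/
theorem hoffmanDual_sum : ∀ k : List ℕ, (∀ i ∈ k, 1 ≤ i) → (hoffmanDual k).sum = k.sum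
  | [], _ => rfl
  | [k], _ => by simp [hoffmanDual]
  | k :: l :: ks, hp => by
      have hp' : ∀ i ∈ l :: ks, 1 ≤ i := fun i hi => hp i (by simp_all)
      have ih := hoffmanDual_sum (l :: ks) hp'
      have hk := hp k (by simp)
      have := plusFirst_sum _ (hoffmanDual_ne_nil (l :: ks) (by simp) hp')
      simp only [hoffmanDual, List.sum_append, List.sum_replicate, this, ih, smul_eq_mul,
        List.sum_cons]
      omega

theorem exists_take_cons (a : ℕ) (l : List ℕ) (s : ℕ) :
    (∃ j, ((a :: l).take j).sum = s) ↔ s = 0 ∨ (a ≤ s ∧ ∃ j, (l.take j).sum = s - a) := by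
  constructor
  · rintro ⟨j, hj⟩
    cases j with
    | zero => left; simpa using hj.symm
    | succ j =>
      right
      simp only [List.take_succ_cons, List.sum_cons] at hj
      exact ⟨by omega, j, by omega⟩
  · rintro (h | ⟨h, j, hj⟩)
    · exact ⟨0, by simp [h]⟩
    · exact ⟨j + 1, by simp only [List.take_succ_cons, List.sum_cons]; omega⟩

theorem exists_take_replicate_append (m : ℕ) (l : List ℕ) (s : ℕ) :
    (∃ j, ((List.replicate m 1 ++ l).take j).sum = s) ↔
      s < m ∨ (m ≤ s ∧ ∃ j, (l.take j).sum = s - m) := by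
  induction m generalizing s with
  | zero => simp
  | succ m ih =>
    rw [List.replicate_succ, List.cons_append, exists_take_cons, ih]
    rw [show s - 1 - m = s - (m + 1) by omega]
    by_cases h : m + 1 ≤ s
    · have h1 : ¬ s = 0 := by omega
      have h2 : 1 ≤ s := by omega
      have h3 : ¬ (s - 1 < m) := by omega
      have h4 : m ≤ s - 1 := by omega
      have h5 : ¬ s < m + 1 := by omega
      simp [h, h1, h2, h3, h4, h5]
    · have h5 : s < m + 1 := by omega
      simp only [h5, h, true_or, iff_true]
      by_cases h0 : s = 0
      · exact Or.inl h0
      · exact Or.inr ⟨by omega, Or.inl (by omega)⟩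

/-- The proper partial sums of `k` and of its Hoffman dual partition `{1, …, |k| - 1}`. -/
theorem hoffmanDual_partialSums : ∀ k : List ℕ, (∀ i ∈ k, 1 ≤ i) → ∀ s, 1 ≤ s → s < k.sum →
    ((∃ j, ((hoffmanDual k).take j).sum = s) ↔ ¬ ∃ j, (k.take j).sum = s)
  | [], _, s, _, h2 => by simp at h2
  | [k], _, s, h1, h2 => by
      simp only [List.sum_cons, List.sum_nil, add_zero] at h2
      have h := exists_take_replicate_append k [] s
      rw [List.append_nil] at h
      rw [hoffmanDual, h, exists_take_cons]
      have h3 : ¬ k ≤ s := by omega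
      have h4 : ¬ s = 0 := by omega
      simp [h2, h3, h4]
  | k :: l :: ks, hp, s, h1, h2 => by
      have hp' : ∀ i ∈ l :: ks, 1 ≤ i := fun i hi => hp i (by simp_all)
      have hk := hp k (by simp)
      have ih := hoffmanDual_partialSums (l :: ks) hp' (s - k)
      have hne := hoffmanDual_ne_nil (l :: ks) (by simp) hp'
      rw [List.sum_cons] at h2
      rw [hoffmanDual, exists_take_replicate_append, exists_take_cons]
      have hpos := hoffmanDual_pos (l :: ks)
      generalize hoffmanDual (l :: ks) = D at *
      have h4 : ¬ s = 0 := by omega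
      cases D with
      | nil => exact absurd rfl hne
      | cons d D =>
        rw [plusFirst, exists_take_cons]
        rw [exists_take_cons] at ih
        by_cases hs : s < k - 1
        · have : ¬ k ≤ s := by omega
          simp [hs, h4, this]
        · by_cases hs' : s = k - 1
          · have : ¬ k ≤ s := by omega
            have h5 : k - 1 ≤ s := by omega
            have h6 : s - (k - 1) = 0 := by omega
            simp [hs, h4, this, h5, h6]
          · by_cases hs2 : s = k
            · subst hs2
              have h6 : s - (s - 1) = 1 := by omega
              have h7 : ∃ j, (List.take j (l :: ks)).sum = 0 := ⟨0, by simp⟩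
              have hd : ¬ (s < s - 1) := by omega
              simp only [h4, hd, h6, Nat.sub_self, h7, le_refl, and_true, or_true, not_true,
                false_or, iff_false]
              have hd1 := hpos d (by simp)
              rintro ⟨-, h | ⟨h, -⟩⟩ <;> omega
            · have e1 : 1 ≤ s - k := by clear ih; omega
              have e2 : s - k < (l :: ks).sum := by clear ih; omega
              have ih := ih e1 e2
              have h5 : k - 1 ≤ s := by clear ih; omega
              have h6 : ¬ s - (k - 1) = 0 := by clear ih; omega
              have h7 : ¬ s - k = 0 := by clear ih; omega
              have h8 : k ≤ s := by clear ih; omega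
              have h9 : s - (k - 1) - (d + 1) = s - k - d := by clear ih; omega
              have h10 : d + 1 ≤ s - (k - 1) ↔ d ≤ s - k := by clear ih; omega
              simp only [hs, h5, h6, h4, h7, h8, h9, h10, false_or, true_and] at ih ⊢
              exact ih

/-! The identity is the coefficient of `X ^ m` in a duality over `PowerSeries ℂ`, proved by
connected sums. With a = 1 - α, take the weights 1/n on one side, w_p = 1/(p - 1 + a - X) on the
other, and join two nested sums by the connector C(n,p) = n! w_{p+1} ⋯ w_{p+n}. The partial fraction
1/x = 1/(x+n) + n/(x(x+n)) yields two telescoping relations, ∑_{p>q} C(n,p) w_p = C(n,q)/n and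
∑_{n>m} C(n,p)/n = C(m,p) w_p. Each lets one letter of a word cross the connector and come out
complemented (`hasSum_connTriple`). Once all letters have crossed, the word of k, prefixed by
`true`, has been complemented and reversed, which is the word of K (`reverse_map_not_word`); this
gives `exists_hasSum_formal_duality`.

On the left, C(n,0) = n!/∏_{i<n}(i + a - X) has as coefficients the star sums divided by the
binomial (`coeff_prod_formalWeight`, `gammaBinom_sub`). On the right, the negative binomial series
of the powers of w_p produces B(K; j) (`coeff_weightedMHS_formalWeight`).

The interchanges of summation rest on a majorant: the same transport is run with weights in [0,∞],
where every series has a sum, and a weighted ℓ¹ norm on power series compares the two settings. The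
majorant is finite (`tsum_connTerm_ne_top`) because it can be enlarged to a connected sum whose dual
is bounded by ∑ 1/(p+b)^{r+2}. -/

section Connected

/-! ### Words, nested sums and the connector over a commutative semiring. -/

variable {R : Type*} [CommSemiring R]

/-- One letter of a word acts on a sequence `u`: `true` multiplies `u n` by the weight `w n`,
`false` multiplies the partial sum of `u` below `n` by `w n`. -/
def wstep (w : ℕ → R) (b : Bool) (u : ℕ → R) (n : ℕ) : R :=
  w n * cond b (u n) (∑ m ∈ Finset.range n, u m)

/-- The sequence obtained from the indicator of `0` by the letters of a word. -/
def wordSum (w : ℕ → R) (L : List Bool) : ℕ → R :=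
  L.foldr (wstep w) (Pi.single 0 1)

/-- The sequence obtained from `v` by the complements of the letters of a word, first letter
first. -/
def dualFold (w : ℕ → R) (L : List Bool) (v : ℕ → R) : ℕ → R :=
  L.foldl (fun v b => wstep w (!b) v) v

/-- The word of a tuple of positive integers. -/
def word : List ℕ → List Bool
  | [] => []
  | k :: ks => List.replicate (k - 1) true ++ false :: word ks

/-- The word of a nonempty tuple of positive integers without its final letter `false`. -/
def innerWord : List ℕ → List Bool
  | [] => []
  | [k] => List.replicate (k - 1) true
  | k :: l :: ks => List.replicate (k - 1) true ++ false :: innerWord (l :: ks)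

/-- The multiple harmonic sum with weights `w`. -/
def weightedMHS (w : ℕ → R) : ℕ → List ℕ → R
  | _, [] => 1
  | n, k :: ks => ∑ m ∈ Finset.Icc 1 n, w m ^ k * weightedMHS w (m - 1) ks

/-- The connector `n! / ((p + a) ⋯ (p + a + n - 1))` for the weights `w p = 1 / (p + a - 1)`. -/
def connector (w : ℕ → R) (n p : ℕ) : R :=
  (n.factorial : R) * ∏ i ∈ Finset.range n, w (p + 1 + i)

@[simp] theorem connector_zero (w : ℕ → R) (p : ℕ) : connector w 0 p = 1 := by
  simp [connector]

theorem wstep_true (w u : ℕ → R) (n : ℕ) : wstep w true u n = w n * u n := rfl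

theorem wstep_false (w u : ℕ → R) (n : ℕ) :
    wstep w false u n = w n * ∑ m ∈ Finset.range n, u m := rfl

theorem wstep_zero {w : ℕ → R} (hw : w 0 = 0) (b : Bool) (u : ℕ → R) : wstep w b u 0 = 0 := by
  simp [wstep, hw]

theorem wordSum_cons (w : ℕ → R) (b : Bool) (L : List Bool) :
    wordSum w (b :: L) = wstep w b (wordSum w L) := rfl

theorem wordSum_replicate_true_append (w : ℕ → R) (k : ℕ) (L : List Bool) (n : ℕ) :
    wordSum w (List.replicate k true ++ L) n = w n ^ k * wordSum w L n := by
  induction k with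
  | zero => simp
  | succ k ih =>
    rw [List.replicate_succ, List.cons_append, wordSum_cons, wstep_true, ih, pow_succ']
    ring

/-- The letter that crosses first ends up innermost, which is why the order is reversed. -/
theorem dualFold_eq_wordSum (w : ℕ → R) (L : List Bool) :
    dualFold w L (Pi.single 0 1) = wordSum w (L.map not).reverse := by
  rw [dualFold, wordSum, List.foldr_reverse, List.foldl_map]

theorem wordSum_word_cons {w : ℕ → R} {k : ℕ} (hk : 1 ≤ k) (ks : List ℕ)
    (n : ℕ) : wordSum w (word (k :: ks)) n =
      w n ^ k * ∑ m ∈ Finset.range n, wordSum w (word ks) m := by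
  obtain ⟨k, rfl⟩ := Nat.exists_eq_add_of_le' hk
  rw [word, wordSum_replicate_true_append, wordSum_cons, wstep_false, Nat.add_sub_cancel, pow_succ]
  ring

/-- Each `false` opens a strict inner sum. The indicator of 0 makes the empty tuple contribute 1,
while `w 0 = 0` removes the index 0 for every other tuple. -/
theorem sum_wordSum_word {w : ℕ → R} (hw : w 0 = 0) :
    ∀ (ks : List ℕ), (∀ i ∈ ks, 1 ≤ i) → ∀ n,
      ∑ m ∈ Finset.range (n + 1), wordSum w (word ks) m = weightedMHS w n ks
  | [], _, n => by
      rw [Finset.sum_range_succ', Finset.sum_eq_zero]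
      · simp [wordSum, word, weightedMHS]
      · intro i _
        simp [wordSum, word]
  | k :: ks, h, n => by
      have hk : 1 ≤ k := h k (by simp)
      have ih := sum_wordSum_word hw ks (fun i hi => h i (by simp [hi]))
      rw [weightedMHS, Finset.range_eq_Ico, Finset.sum_eq_sum_Ico_succ_bot (by omega),
        wordSum_word_cons hk, hw, zero_pow (by omega), zero_mul, zero_add]
      refine Finset.sum_congr (by ext; simp) fun m hm => ?_
      have hm1 : 1 ≤ m := by simp at hm; omega
      obtain ⟨m, rfl⟩ := Nat.exists_eq_add_of_le' hm1
      rw [wordSum_word_cons hk, ih, Nat.add_sub_cancel]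

theorem wordSum_word_cons_succ {w : ℕ → R} (hw : w 0 = 0) {k : ℕ} {ks : List ℕ}
    (h : ∀ i ∈ k :: ks, 1 ≤ i) (n : ℕ) :
    wordSum w (word (k :: ks)) (n + 1) = w (n + 1) ^ k * weightedMHS w n ks := by
  rw [wordSum_word_cons (h k (by simp)), sum_wordSum_word hw ks (fun i hi => h i (by simp [hi]))]

end Connected

/-! ### Hoffman duality as complementation of words. -/

section Words

theorem word_replicate_one_append (n : ℕ) (D : List ℕ) :
    word (List.replicate n 1 ++ D) = List.replicate n false ++ word D := by
  induction n with
  | zero => simp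
  | succ n ih => simp [List.replicate_succ, word, ih]

theorem word_plusFirst {D : List ℕ} (hD : D ≠ []) (h : ∀ i ∈ D, 1 ≤ i) :
    word (plusFirst D) = true :: word D := by
  cases D with
  | nil => exact absurd rfl hD
  | cons a D =>
    obtain ⟨a, rfl⟩ := Nat.exists_eq_add_of_le' (h a (by simp))
    simp [plusFirst, word, List.replicate_succ]

theorem word_eq_innerWord : ∀ k : List ℕ, k ≠ [] → word k = innerWord k ++ [false]
  | [], h => absurd rfl h
  | [k], _ => by simp [word, innerWord]
  | k :: l :: ks, _ => by
      rw [word, word_eq_innerWord (l :: ks) (by simp), innerWord]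
      simp

/-- Inner letters encode the gaps between consecutive ones, `true` for a plus and `false` for a
comma, and the dual swaps them. The final `false` belongs to no gap and stays. -/
theorem word_hoffmanDual : ∀ k : List ℕ, k ≠ [] → (∀ i ∈ k, 1 ≤ i) →
    word (hoffmanDual k) = (innerWord k).map not ++ [false]
  | [], h, _ => absurd rfl h
  | [k], _, h => by
      obtain ⟨k, rfl⟩ := Nat.exists_eq_add_of_le' (h k (by simp))
      have := word_replicate_one_append (k + 1) []
      rw [List.append_nil] at this
      rw [hoffmanDual, this]
      simp [innerWord, word, List.replicate_succ']
  | k :: l :: ks, _, h => by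
      have hp : ∀ i ∈ l :: ks, 1 ≤ i := fun i hi => h i (by simp_all)
      rw [hoffmanDual, word_replicate_one_append,
        word_plusFirst (hoffmanDual_ne_nil _ (by simp) hp) (hoffmanDual_pos _),
        word_hoffmanDual (l :: ks) (by simp) hp, innerWord]
      simp

theorem innerWord_concat : ∀ (k : List ℕ) (l : ℕ), k ≠ [] →
    innerWord (k ++ [l]) = innerWord k ++ false :: List.replicate (l - 1) true
  | [], _, h => absurd rfl h
  | [k], l, _ => by simp [innerWord]
  | k :: k' :: ks, l, _ => by
      have := innerWord_concat (k' :: ks) l (by simp)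
      simp only [List.cons_append] at this ⊢
      rw [innerWord, this, innerWord]
      simp

theorem innerWord_reverse : ∀ k : List ℕ, innerWord k.reverse = (innerWord k).reverse
  | [] => rfl
  | [k] => by simp [innerWord]
  | k :: l :: ks => by
      rw [List.reverse_cons, innerWord_concat _ _ (by simp), innerWord_reverse (l :: ks), innerWord]
      simp

/-- Reversing and complementing the word `true :: word k` gives the word of the tuple on the other
side of the duality. -/
theorem reverse_map_not_word {k : List ℕ} (hk : k ≠ []) (h : ∀ i ∈ k, 1 ≤ i) :
    ((true :: word k).map not).reverse = word (plusFirst (hoffmanDual k.reverse)) := by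
  have hr : ∀ i ∈ k.reverse, 1 ≤ i := fun i hi => h i (by simpa using hi)
  rw [word_plusFirst (hoffmanDual_ne_nil _ (by simpa using hk) hr) (hoffmanDual_pos _),
    word_hoffmanDual _ (by simpa using hk) hr, innerWord_reverse, word_eq_innerWord k hk]
  simp

end Words

/-! ### Transport of a letter across the connector. -/

section Transport

variable {R : Type*} [CommSemiring R]

/-- The two connectors share all factors but the first of one and the last of the other, and `hw` is
the partial fraction relating those. It is written without subtraction so as to cover [0,∞]. -/
theorem connector_eq_add_succ_right {w : ℕ → R}
    (hw : ∀ p n : ℕ, w (p + 1) = w (p + 1 + n) + n * w (p + 1) * w (p + 1 + n)) (n q : ℕ) :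
    connector w n q = connector w n (q + 1) + n * (connector w n (q + 1) * w (q + 1)) := by
  cases n with
  | zero => simp
  | succ m =>
    rw [connector, connector, Finset.prod_range_succ', Finset.prod_range_succ]
    have e : ∏ i ∈ Finset.range m, w (q + 1 + (i + 1)) = ∏ i ∈ Finset.range m, w (q + 1 + 1 + i) :=
      Finset.prod_congr rfl fun i _ => by rw [add_right_comm (q + 1) 1 i, add_assoc (q + 1) i 1]
    have e2 : q + 1 + (m + 1) = q + 1 + 1 + m := by ring
    have h := hw q (m + 1)
    rw [e2] at h
    rw [e, add_zero]
    generalize ∏ i ∈ Finset.range m, w (q + 1 + 1 + i) = P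
    calc _ = ((m + 1).factorial : R) * P * w (q + 1) := by ring
      _ = ((m + 1).factorial : R) * P * (w (q + 1 + 1 + m) +
          ((m + 1 : ℕ) : R) * w (q + 1) * w (q + 1 + 1 + m)) := by rw [← h]
      _ = _ := by ring

theorem connector_mul_eq_add_succ_left {w η : ℕ → R}
    (hw : ∀ p n : ℕ, w (p + 1) = w (p + 1 + n) + n * w (p + 1) * w (p + 1 + n))
    (hη : ∀ n : ℕ, η (n + 1) * (n + 1 : ℕ) = 1) (n p : ℕ) :
    connector w n (p + 1) * w (p + 1) = connector w (n + 1) (p + 1) * w (p + 1) +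
      η (n + 1) * connector w (n + 1) (p + 1) := by
  rw [connector, connector, Finset.prod_range_succ, Nat.factorial_succ]
  have h := hw p (n + 1)
  have e : p + 1 + (n + 1) = p + 1 + 1 + n := by ring
  rw [e] at h
  generalize ∏ i ∈ Finset.range n, w (p + 1 + 1 + i) = P
  have h1 := hη n
  calc _ = (n.factorial : R) * P * w (p + 1) := by ring
    _ = (n.factorial : R) * P * (w (p + 1 + 1 + n) +
          ((n + 1 : ℕ) : R) * w (p + 1) * w (p + 1 + 1 + n)) := by rw [← h]
    _ = (n.factorial : R) * P * ((η (n + 1) * (n + 1 : ℕ)) * w (p + 1 + 1 + n) +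
          ((n + 1 : ℕ) : R) * w (p + 1) * w (p + 1 + 1 + n)) := by rw [h1, one_mul]
    _ = _ := by push_cast; ring

variable [TopologicalSpace R]

theorem hasSum_of_telescope {R : Type*} [AddCommMonoid R] [TopologicalSpace R] [ContinuousAdd R]
    [T2Space R] {f t : ℕ → R} (hf : Summable f) (h : ∀ n, t n = t (n + 1) + f n)
    (ht : Tendsto t atTop (𝓝 0)) : HasSum f (t 0) := by
  obtain ⟨s, hs⟩ := hf
  have h1 : ∀ n, ∑ i ∈ Finset.range n, f i + t n = t 0 := by
    intro n
    induction n with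
    | zero => simp
    | succ n ih => rw [Finset.sum_range_succ, ← ih, h n, add_assoc, add_comm (f n)]
  have h2 := hs.tendsto_sum_nat.add ht
  simp only [h1, add_zero] at h2
  rwa [tendsto_nhds_unique tendsto_const_nhds h2]

/-- The properties of the weights that make the connected sum invariant. -/
structure ConnectedWeights (η w : ℕ → R) : Prop where
  left_zero : η 0 = 0
  right_zero : w 0 = 0
  -- Required separately because multiplication on [0,∞] is not continuous.
  mul_hasSum : ∀ (a : R) (f : ℕ → R) (s : R), HasSum f s → HasSum (fun n => a * f n) (a * s)
  -- Index 0 is excluded from both relations: `connector w 0 p` is 1, which leaves the bare series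
  -- of the weights, and `w 0 = 0` is a convention.
  hasSum_right : ∀ n q : ℕ, HasSum (fun p => if q < p then connector w (n + 1) p * w p else 0)
    (η (n + 1) * connector w (n + 1) q)
  hasSum_left : ∀ m p : ℕ, HasSum (fun n => if m < n then η n * connector w n (p + 1) else 0)
    (connector w m (p + 1) * w (p + 1))

theorem hasSum_ite_lt {R : Type*} [AddCommMonoid R] [TopologicalSpace R] {f : ℕ → R} {q : ℕ} {s : R}
    (h : HasSum (fun i => f (q + i + 1)) s) : HasSum (fun p => if q < p then f p else 0) s := by
  have hinj : Function.Injective (fun i : ℕ => q + i + 1) := fun i j hij => by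
    simpa using hij
  rw [← hinj.hasSum_iff]
  · convert h using 2 with i
    simp only [Function.comp]
    rw [if_pos (by omega)]
  · intro p hp
    rw [if_neg]
    intro hlt
    exact hp ⟨p - q - 1, by simp only; omega⟩

theorem ConnectedWeights.of_tendsto [ContinuousAdd R] [T2Space R] {η w : ℕ → R}
    (hη0 : η 0 = 0) (hw0 : w 0 = 0)
    (hmul : ∀ (a : R) (f : ℕ → R) (s : R), HasSum f s → HasSum (fun n => a * f n) (a * s))
    (hw : ∀ p n : ℕ, w (p + 1) = w (p + 1 + n) + n * w (p + 1) * w (p + 1 + n))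
    (hη : ∀ n : ℕ, η (n + 1) * (n + 1 : ℕ) = 1)
    (h1 : ∀ n q, Summable fun i => connector w (n + 1) (q + i + 1) * w (q + i + 1))
    (h2 : ∀ m p, Summable fun i => η (m + i + 1) * connector w (m + i + 1) (p + 1))
    (t1 : ∀ n q, Tendsto (fun i => η (n + 1) * connector w (n + 1) (q + i)) atTop (𝓝 0))
    (t2 : ∀ m p, Tendsto (fun i => connector w (m + i) (p + 1) * w (p + 1)) atTop (𝓝 0)) :
    ConnectedWeights η w where
  left_zero := hη0
  right_zero := hw0
  mul_hasSum := hmul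
  hasSum_right n q := by
    apply hasSum_ite_lt
    refine hasSum_of_telescope (t := fun i => η (n + 1) * connector w (n + 1) (q + i)) (h1 n q)
      (fun i => ?_) (t1 n q)
    rw [connector_eq_add_succ_right hw (n + 1) (q + i), mul_add, ← mul_assoc (η (n + 1)), hη,
      one_mul, add_assoc q i 1]
  hasSum_left m p := by
    apply hasSum_ite_lt
    refine hasSum_of_telescope (t := fun i => connector w (m + i) (p + 1) * w (p + 1)) (h2 m p)
      (fun i => ?_) (t2 m p)
    exact connector_mul_eq_add_succ_left hw hη (m + i) p

/-- The summand of the connected sum of two sequences. -/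
def connTerm (w u v : ℕ → R) (x : ℕ × ℕ) : R := u x.1 * connector w x.1 x.2 * v x.2

/-- The triple series that moves a letter from one side of the connected sum to the other. -/
def connTriple (η w : ℕ → R) (b : Bool) (u v : ℕ → R) (x : (ℕ × ℕ) × ℕ) : R :=
  cond b (if x.1.2 < x.2 then u x.1.1 * connector w x.1.1 x.2 * w x.2 * v x.1.2 else 0)
    (if x.1.1 < x.2 then u x.1.1 * η x.2 * connector w x.2 x.1.2 * v x.1.2 else 0)

theorem hasSum_swap_second_third {M : Type*} [AddCommMonoid M] [TopologicalSpace M]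
    {f : (ℕ × ℕ) × ℕ → M} {s : M} (h : HasSum f s) :
    HasSum (fun x : (ℕ × ℕ) × ℕ => f ((x.1.1, x.2), x.1.2)) s :=
  (Equiv.hasSum_iff (⟨fun x => ((x.1.1, x.2), x.1.2), fun x => ((x.1.1, x.2), x.1.2),
    fun _ => rfl, fun _ => rfl⟩ : (ℕ × ℕ) × ℕ ≃ (ℕ × ℕ) × ℕ)).2 h

theorem hasSum_swap_first_third {M : Type*} [AddCommMonoid M] [TopologicalSpace M]
    {f : (ℕ × ℕ) × ℕ → M} {s : M} (h : HasSum f s) :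
    HasSum (fun x : (ℕ × ℕ) × ℕ => f ((x.2, x.1.2), x.1.1)) s :=
  (Equiv.hasSum_iff (⟨fun x => ((x.2, x.1.2), x.1.1), fun x => ((x.2, x.1.2), x.1.1),
    fun _ => rfl, fun _ => rfl⟩ : (ℕ × ℕ) × ℕ ≃ (ℕ × ℕ) × ℕ)).2 h

/-- One triple series is summed in two orders: one inner sum is a transport relation, the other is
the partial sum inside `wstep`. The conditions at 0 cover the index where the transport relation is
unavailable. -/
theorem hasSum_connTriple [ContinuousAdd R] [T3Space R] {η w : ℕ → R} (D : ConnectedWeights η w)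
    {b : Bool} {u v : ℕ → R} (hu : b = true → u 0 = 0) (hv : b = false → v 0 = 0) {s : R}
    (hs : HasSum (connTriple η w b u v) s) :
    HasSum (connTerm w (wstep η b u) v) s ∧ HasSum (connTerm w u (wstep w (!b) v)) s := by
  have swap23 := hasSum_swap_second_third hs
  have swap13 := hasSum_swap_first_third hs
  cases b with
  | true =>
    refine ⟨hs.prod_fiberwise fun ⟨n, q⟩ => ?_, swap23.prod_fiberwise fun ⟨n, p⟩ => ?_⟩
    · cases n with
      | zero => simp [connTriple, connTerm, wstep, D.left_zero, hu]
      | succ n =>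
        have := D.mul_hasSum (u (n + 1) * v q) _ _ (D.hasSum_right n q)
        convert this using 1
        · ext p
          simp only [connTriple, cond_true, mul_ite, mul_zero]
          split_ifs <;> ring
        · simp only [connTerm, wstep_true]
          ring
    · have : connTerm w u (wstep w (!true) v) (n, p) = ∑ q ∈ Finset.range p,
          connTriple η w true u v ((n, q), p) := by
        simp only [connTerm, Bool.not_true, wstep_false, connTriple, cond_true, Finset.mul_sum]
        refine Finset.sum_congr rfl fun q hq => ?_
        rw [if_pos (Finset.mem_range.1 hq)]
        ring
      rw [this]
      refine hasSum_sum_of_ne_finset_zero fun q hq => ?_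
      simp only [connTriple, cond_true]
      rw [if_neg (by simpa using hq)]
  | false =>
    refine ⟨swap13.prod_fiberwise fun ⟨n, p⟩ => ?_, hs.prod_fiberwise fun ⟨m, p⟩ => ?_⟩
    · have : connTerm w (wstep η false u) v (n, p) = ∑ m ∈ Finset.range n,
          connTriple η w false u v ((m, p), n) := by
        simp only [connTerm, wstep_false, connTriple, cond_false, Finset.mul_sum, Finset.sum_mul]
        refine Finset.sum_congr rfl fun q hq => ?_
        rw [if_pos (Finset.mem_range.1 hq)]
        ring
      rw [this]
      refine hasSum_sum_of_ne_finset_zero fun q hq => ?_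
      simp only [connTriple, cond_false]
      rw [if_neg (by simpa using hq)]
    · cases p with
      | zero => simp [connTriple, connTerm, wstep, D.right_zero, hv]
      | succ p =>
        have := D.mul_hasSum (u m * v (p + 1)) _ _ (D.hasSum_left m p)
        convert this using 1
        · ext n
          simp only [connTriple, cond_false, mul_ite, mul_zero]
          split_ifs <;> ring
        · simp only [connTerm, Bool.not_false, wstep_true]
          ring

/-- Since `connector w 0 p = 1`, an exhausted left word leaves an ordinary series. -/
theorem hasSum_connTerm_left_single [T2Space R] (w v : ℕ → R) {s : R} :
    HasSum (connTerm w (Pi.single 0 1) v) s ↔ HasSum v s := by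
  have hinj : Function.Injective (fun p : ℕ => ((0, p) : ℕ × ℕ)) := fun i j h => by simpa using h
  rw [← hinj.hasSum_iff]
  · congr! 1
    ext p
    simp [connTerm]
  · rintro ⟨n, p⟩ h
    have hn : n ≠ 0 := fun h0 => h ⟨p, by simp [h0]⟩
    simp [connTerm, hn]

theorem hasSum_connTerm_right_single [T2Space R] (w u : ℕ → R) {s : R} :
    HasSum (connTerm w u (Pi.single 0 1)) s ↔ HasSum (fun n => u n * connector w n 0) s := by
  have hinj : Function.Injective (fun n : ℕ => ((n, 0) : ℕ × ℕ)) := fun i j h => by simpa using h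
  rw [← hinj.hasSum_iff]
  · congr! 1
    ext p
    simp [connTerm]
  · rintro ⟨n, p⟩ h
    have hn : p ≠ 0 := fun h0 => h ⟨n, by simp [h0]⟩
    simp [connTerm, hn]

end Transport

/-! ### The majorant in [0,∞] and its finiteness. -/

section Majorant

open scoped ENNReal

/-- The weights `1 / (p - 1 + b)` for `p ≥ 1`, as extended nonnegative reals. -/
noncomputable def majorWeight (b : ℝ) : ℕ → ℝ≥0∞
  | 0 => 0
  | p + 1 => ENNReal.ofReal ((p + b)⁻¹)

/-- The weights `1 / n` for `n ≥ 1`, as extended nonnegative reals. -/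
noncomputable def harmonicWeight : ℕ → ℝ≥0∞
  | 0 => 0
  | n + 1 => ((n + 1 : ℕ) : ℝ≥0∞)⁻¹

theorem harmonicWeight_le_one (n : ℕ) : harmonicWeight n ≤ 1 := by
  cases n with
  | zero => simp [harmonicWeight]
  | succ n =>
    rw [harmonicWeight, ENNReal.inv_le_one]
    exact_mod_cast Nat.le_add_left 1 n

theorem harmonicWeight_mul (n : ℕ) : harmonicWeight (n + 1) * (n + 1 : ℕ) = 1 :=
  ENNReal.inv_mul_cancel (by simp) (ENNReal.natCast_ne_top _)

variable {b : ℝ}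

theorem majorWeight_ne_top (p : ℕ) : majorWeight b p ≠ ∞ := by
  cases p <;> simp [majorWeight]

theorem majorWeight_le (hb : 0 < b) (p : ℕ) : majorWeight b p ≤ ENNReal.ofReal b⁻¹ := by
  cases p with
  | zero => simp [majorWeight]
  | succ p =>
    apply ENNReal.ofReal_le_ofReal
    gcongr
    simp

theorem majorWeight_relation (hb : 0 < b) (p n : ℕ) :
    majorWeight b (p + 1) = majorWeight b (p + 1 + n) +
      n * majorWeight b (p + 1) * majorWeight b (p + 1 + n) := by
  rw [show p + 1 + n = (p + n) + 1 by ring, majorWeight, majorWeight, ← ENNReal.ofReal_natCast n,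
    ← ENNReal.ofReal_mul (by positivity), ← ENNReal.ofReal_mul (by positivity),
    ← ENNReal.ofReal_add (by positivity) (by positivity)]
  congr 1
  have h1 : (p : ℝ) + b ≠ 0 := by positivity
  have h2 : ((p + n : ℕ) : ℝ) + b ≠ 0 := by positivity
  field_simp
  push_cast
  ring

theorem tendsto_majorWeight (b : ℝ) : Tendsto (majorWeight b) atTop (𝓝 0) := by
  rw [← tendsto_add_atTop_iff_nat 1, ← ENNReal.ofReal_zero]
  apply ENNReal.tendsto_ofReal
  exact tendsto_inv_atTop_zero.comp
    (tendsto_atTop_add_const_right _ _ tendsto_natCast_atTop_atTop)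

theorem tendsto_connector_majorWeight_right (hb : 0 < b) (n : ℕ) :
    Tendsto (connector (majorWeight b) (n + 1)) atTop (𝓝 0) := by
  have h : Tendsto (fun p => (((n + 1).factorial : ℝ≥0∞) * ENNReal.ofReal b⁻¹ ^ n) *
      majorWeight b (p + 1)) atTop (𝓝 0) := by
    have := ENNReal.Tendsto.const_mul (a := ((n + 1).factorial : ℝ≥0∞) * ENNReal.ofReal b⁻¹ ^ n)
      ((tendsto_add_atTop_iff_nat 1).2 (tendsto_majorWeight b)) (Or.inr (by finiteness))
    simpa using this
  refine tendsto_of_tendsto_of_tendsto_of_le_of_le tendsto_const_nhds h (fun _ => zero_le)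
    fun p => ?_
  simp only
  rw [connector, Finset.prod_range_succ', mul_assoc, add_zero]
  gcongr
  calc _ ≤ ∏ i ∈ Finset.range n, ENNReal.ofReal b⁻¹ :=
        Finset.prod_le_prod' fun i _ => majorWeight_le hb _
    _ = _ := by simp

theorem connector_majorWeight_eq (hb : 0 < b) (n p : ℕ) :
    connector (majorWeight b) n p =
      ENNReal.ofReal (n.factorial * ∏ i ∈ Finset.range n, ((p : ℝ) + b + i)⁻¹) := by
  rw [connector, ENNReal.ofReal_mul (by positivity), ENNReal.ofReal_natCast,
    ENNReal.ofReal_prod_of_nonneg (fun i _ => by positivity)]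
  congr 1
  refine Finset.prod_congr rfl fun i _ => ?_
  rw [add_right_comm, majorWeight]
  push_cast
  ring_nf

theorem tendsto_connector_majorWeight_left (hb : 0 < b) (p : ℕ) :
    Tendsto (fun n => connector (majorWeight b) n (p + 1)) atTop (𝓝 0) := by
  simp only [connector_majorWeight_eq hb]
  rw [← ENNReal.ofReal_zero]
  apply ENNReal.tendsto_ofReal
  have hs : 0 < (p : ℝ) + b := by positivity
  set s : ℝ := p + b with hs'
  -- Euler's limit: n!/((s+1)⋯(s+n)) equals s · `GammaSeq s n` · n^(-s).
  have h := ((Real.GammaSeq_tendsto_Gamma s).mul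
    ((tendsto_rpow_neg_atTop hs).comp tendsto_natCast_atTop_atTop)).const_mul s
  rw [mul_zero, mul_zero] at h
  refine h.congr' ?_
  filter_upwards [eventually_gt_atTop 0] with n hn
  have hn' : (0 : ℝ) < n := by exact_mod_cast hn
  simp only [Function.comp, Real.GammaSeq]
  rw [Finset.prod_range_succ', Nat.cast_zero, add_zero, Real.rpow_neg hn'.le]
  have e : ∏ i ∈ Finset.range n, (((p + 1 : ℕ) : ℝ) + b + i)⁻¹ =
      (∏ i ∈ Finset.range n, (s + ((i + 1 : ℕ) : ℝ)))⁻¹ := by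
    rw [← Finset.prod_inv_distrib]
    refine Finset.prod_congr rfl fun i _ => ?_
    rw [hs']
    push_cast
    ring_nf
  rw [e]
  have hP : ∏ i ∈ Finset.range n, (s + ((i + 1 : ℕ) : ℝ)) ≠ 0 :=
    (Finset.prod_pos fun i _ => by positivity).ne'
  have := (Real.rpow_pos_of_pos hn' s).ne'
  field_simp

theorem connectedWeights_majorWeight (hb : 0 < b) :
    ConnectedWeights harmonicWeight (majorWeight b) :=
  ConnectedWeights.of_tendsto rfl rfl
    (fun a f s h => by
      rw [← h.tsum_eq, ← ENNReal.tsum_mul_left]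
      exact ENNReal.summable.hasSum)
    (majorWeight_relation hb) harmonicWeight_mul (fun _ _ => ENNReal.summable)
    (fun _ _ => ENNReal.summable)
    (fun n q => by
      have h := ENNReal.Tendsto.const_mul (a := harmonicWeight (n + 1))
        ((tendsto_add_atTop_iff_nat q).2 (tendsto_connector_majorWeight_right hb n))
        (Or.inr (ne_top_of_le_ne_top ENNReal.one_ne_top (harmonicWeight_le_one _)))
      simpa only [add_comm, mul_zero] using h)
    (fun m p => by
      have h := ENNReal.Tendsto.mul_const (b := majorWeight b (p + 1))
        ((tendsto_add_atTop_iff_nat m).2 (tendsto_connector_majorWeight_left hb p))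
        (Or.inr (majorWeight_ne_top _))
      simpa only [add_comm, zero_mul] using h)

theorem tsum_connTriple (hb : 0 < b) {c : Bool} {u v : ℕ → ℝ≥0∞} (hu : c = true → u 0 = 0)
    (hv : c = false → v 0 = 0) :
    ∑' x, connTriple harmonicWeight (majorWeight b) c u v x =
        ∑' x, connTerm (majorWeight b) (wstep harmonicWeight c u) v x ∧
      ∑' x, connTerm (majorWeight b) u (wstep (majorWeight b) (!c) v) x =
        ∑' x, connTerm (majorWeight b) (wstep harmonicWeight c u) v x := by
  obtain ⟨h1, h2⟩ := hasSum_connTriple (connectedWeights_majorWeight hb) hu hv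
    ENNReal.summable.hasSum
  exact ⟨h1.tsum_eq.symm, h2.tsum_eq.trans h1.tsum_eq.symm⟩

theorem wordSum_apply_zero {R : Type*} [CommSemiring R] {w : ℕ → R} (hw : w 0 = 0)
    {L : List Bool} (hL : L ≠ []) : wordSum w L 0 = 0 := by
  cases L with
  | nil => exact absurd rfl hL
  | cons c L => exact wstep_zero hw _ _

/-- The last letter must be `false`: it acts on the indicator of 0, which does not vanish at 0, so a
`true` could not cross there. -/
theorem tsum_connTerm_wordSum (hb : 0 < b) (L : List Bool) {v : ℕ → ℝ≥0∞} (hv : v 0 = 0) :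
    ∑' x, connTerm (majorWeight b) (wordSum harmonicWeight (L ++ [false])) v x =
      ∑' p, dualFold (majorWeight b) (L ++ [false]) v p := by
  induction L generalizing v with
  | nil =>
    have h := (tsum_connTriple hb (c := false) (u := Pi.single 0 1) (v := v) (by simp)
      (fun _ => hv)).2
    rw [List.nil_append, wordSum_cons, wordSum, List.foldr_nil, ← h]
    exact ((hasSum_connTerm_left_single _ _).1 ENNReal.summable.hasSum).tsum_eq.symm
  | cons c L ih =>
    rw [List.cons_append, wordSum_cons, ← (tsum_connTriple hb
      (fun _ => wordSum_apply_zero rfl (by simp)) (fun _ => hv)).2, ih (wstep_zero rfl _ _)]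
    rfl

theorem wstep_mono {w : ℕ → ℝ≥0∞} {u v : ℕ → ℝ≥0∞} (h : ∀ n, u n ≤ v n) (c : Bool) (n : ℕ) :
    wstep w c u n ≤ wstep w c v n := by
  cases c
  · exact mul_le_mul_right (Finset.sum_le_sum fun m _ => h m) _
  · exact mul_le_mul_right (h n) _

theorem wordSum_le_filter {w : ℕ → ℝ≥0∞} (hw : ∀ n, w n ≤ 1) (L : List Bool) (n : ℕ) :
    wordSum w L n ≤ wordSum w (L.filter not) n := by
  induction L generalizing n with
  | nil => simp
  | cons c L ih =>
    cases c with
    | false =>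
      rw [List.filter_cons_of_pos (by simp), wordSum_cons, wordSum_cons]
      exact wstep_mono ih _ n
    | true =>
      rw [List.filter_cons_of_neg (by simp), wordSum_cons, wstep_true]
      calc _ ≤ 1 * wordSum w (List.filter not L) n := mul_le_mul' (hw n) (ih n)
        _ = _ := one_mul _

theorem tsum_majorWeight_pow_ne_top (hb : 0 < b) (r : ℕ) :
    ∑' p, majorWeight b p ^ (r + 2) ≠ ∞ := by
  rw [tsum_eq_zero_add' ENNReal.summable]
  have h := (Real.summable_one_div_nat_add_rpow b ((r + 2 : ℕ) : ℝ)).2 (by push_cast; linarith)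
  have e : ∀ p : ℕ, majorWeight b (p + 1) ^ (r + 2) =
      ENNReal.ofReal (1 / |(p : ℝ) + b| ^ ((r + 2 : ℕ) : ℝ)) := by
    intro p
    have : 0 < (p : ℝ) + b := by positivity
    rw [majorWeight, ← ENNReal.ofReal_pow (by positivity), Real.rpow_natCast, abs_of_pos this,
      inv_pow, one_div]
  simp only [e]
  rw [majorWeight, zero_pow (by omega), zero_add]
  exact h.tsum_ofReal_ne_top

/-- As the harmonic weights are at most 1, dropping the `true` letters of `L` only increases the
sum. What remains is dual to the single entry r + 2, hence is bounded by a convergent power series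
in 1/(p+b). The leading `true` is kept, as only a `true` can cross to the indicator on the right. -/
theorem tsum_connTerm_ne_top (hb : 0 < b) (L : List Bool) :
    ∑' x, connTerm (majorWeight b) (wordSum harmonicWeight (true :: (L ++ [false])))
      (Pi.single 0 1) x ≠ ∞ := by
  obtain ⟨r, hr⟩ : ∃ r, L.filter not = List.replicate r false :=
    ⟨_, List.eq_replicate_of_mem (by simp)⟩
  have h1 : ∀ n, wordSum harmonicWeight (true :: (L ++ [false])) n ≤
      wordSum harmonicWeight (true :: (List.replicate r false ++ [false])) n := by
    intro n
    refine wstep_mono (fun m => ?_) _ n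
    refine (wordSum_le_filter harmonicWeight_le_one _ m).trans (le_of_eq ?_)
    rw [List.filter_append, hr]
    rfl
  refine ne_top_of_le_ne_top (tsum_majorWeight_pow_ne_top hb r) ?_
  calc _ ≤ ∑' x, connTerm (majorWeight b)
        (wordSum harmonicWeight (true :: (List.replicate r false ++ [false]))) (Pi.single 0 1) x := by
        refine ENNReal.tsum_le_tsum fun x => ?_
        unfold connTerm
        gcongr
        exact h1 _
    _ = ∑' p, dualFold (majorWeight b) (true :: (List.replicate r false ++ [false]))
          (Pi.single 0 1) p := by
        rw [wordSum_cons, ← (tsum_connTriple hb (fun _ => wordSum_apply_zero rfl (by simp))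
          (by simp)).2, tsum_connTerm_wordSum hb _ (wstep_zero rfl _ _)]
        rfl
    _ ≤ _ := by
        refine ENNReal.tsum_le_tsum fun p => ?_
        have e : ((true :: (List.replicate r false ++ [false])).map not).reverse =
            List.replicate (r + 1) true ++ [false] := by
          simp [List.replicate_succ]
        rw [dualFold_eq_wordSum, e, wordSum_replicate_true_append, pow_succ _ (r + 1)]
        gcongr
        rw [wordSum_cons, wstep_false]
        refine mul_le_of_le_one_right' ?_
        cases p with
        | zero => simp
        | succ p =>
          rw [Finset.sum_range_succ']
          simp [wordSum]

end Majorant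

/-! ### Power series weights and the weighted ℓ¹ norm. -/

section Formal

open scoped ENNReal PowerSeries.WithPiTopology

/-- The weighted `ℓ¹` norm of a power series. -/
noncomputable def weightedNorm (r : ℝ≥0∞) (f : PowerSeries ℂ) : ℝ≥0∞ :=
  ∑' m, ‖PowerSeries.coeff m f‖ₑ * r ^ m

variable {r : ℝ≥0∞}

theorem weightedNorm_C (r : ℝ≥0∞) (z : ℂ) : weightedNorm r (PowerSeries.C z) = ‖z‖ₑ := by
  rw [weightedNorm, tsum_eq_single 0]
  · simp
  · intro m hm
    simp [PowerSeries.coeff_C, hm]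

theorem weightedNorm_zero (r : ℝ≥0∞) : weightedNorm r 0 = 0 := by
  simp [weightedNorm]

theorem weightedNorm_one (r : ℝ≥0∞) : weightedNorm r 1 = 1 := by
  rw [← map_one (PowerSeries.C (R := ℂ)), weightedNorm_C]
  simp

theorem weightedNorm_natCast_le (r : ℝ≥0∞) (n : ℕ) :
    weightedNorm r (n : PowerSeries ℂ) ≤ n := by
  rw [← map_natCast (PowerSeries.C (R := ℂ)), weightedNorm_C, ← ofReal_norm, Complex.norm_natCast,
    ENNReal.ofReal_natCast]

theorem weightedNorm_sum_le {ι : Type*} (s : Finset ι) (f : ι → PowerSeries ℂ) :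
    weightedNorm r (∑ i ∈ s, f i) ≤ ∑ i ∈ s, weightedNorm r (f i) := by
  simp only [weightedNorm]
  rw [← Summable.tsum_finsetSum (fun _ _ => ENNReal.summable)]
  refine ENNReal.tsum_le_tsum fun m => ?_
  rw [← Finset.sum_mul, map_sum]
  gcongr
  exact enorm_sum_le _ _

theorem weightedNorm_mul_le (f g : PowerSeries ℂ) :
    weightedNorm r (f * g) ≤ weightedNorm r f * weightedNorm r g := by
  simp only [weightedNorm]
  calc _ ≤ ∑' m, ∑ x ∈ Finset.HasAntidiagonal.antidiagonal m, (‖PowerSeries.coeff x.1 f‖ₑ * r ^ x.1) *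
        (‖PowerSeries.coeff x.2 g‖ₑ * r ^ x.2) := by
        refine ENNReal.tsum_le_tsum fun m => ?_
        rw [PowerSeries.coeff_mul]
        calc _ ≤ (∑ x ∈ Finset.HasAntidiagonal.antidiagonal m,
              ‖PowerSeries.coeff x.1 f * PowerSeries.coeff x.2 g‖ₑ) * r ^ m := by
              gcongr
              exact enorm_sum_le _ _
          _ = _ := by
              rw [Finset.sum_mul]
              refine Finset.sum_congr rfl fun x hx => ?_
              rw [← Finset.HasAntidiagonal.mem_antidiagonal.1 hx, enorm_mul, pow_add]
              ring
    _ = _ := by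
        rw [← ENNReal.tsum_mul_right]
        simp only [← ENNReal.tsum_mul_left]
        rw [← ENNReal.tsum_prod (f := fun i j => (‖PowerSeries.coeff i f‖ₑ * r ^ i) *
          (‖PowerSeries.coeff j g‖ₑ * r ^ j)), ← (Finset.HasAntidiagonal.sigmaAntidiagonalEquivProd (A := ℕ)).tsum_eq,
          ENNReal.tsum_sigma']
        refine tsum_congr fun m => ?_
        rw [tsum_fintype, ← Finset.sum_coe_sort]
        rfl

theorem weightedNorm_mul_le_of_le {f g : PowerSeries ℂ} {s t : ℝ≥0∞} (hf : weightedNorm r f ≤ s)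
    (hg : weightedNorm r g ≤ t) : weightedNorm r (f * g) ≤ s * t :=
  (weightedNorm_mul_le f g).trans (mul_le_mul' hf hg)

theorem weightedNorm_prod_le {ι : Type*} (s : Finset ι) {f : ι → PowerSeries ℂ} {t : ι → ℝ≥0∞}
    (h : ∀ i ∈ s, weightedNorm r (f i) ≤ t i) :
    weightedNorm r (∏ i ∈ s, f i) ≤ ∏ i ∈ s, t i := by
  classical
  induction s using Finset.induction_on with
  | empty => simp [weightedNorm_one]
  | insert i s hi ih =>
    rw [Finset.prod_insert hi, Finset.prod_insert hi]
    exact weightedNorm_mul_le_of_le (h i (by simp)) (ih fun j hj => h j (by simp [hj]))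

theorem enorm_coeff_mul_le (f : PowerSeries ℂ) (m : ℕ) :
    ‖PowerSeries.coeff m f‖ₑ * r ^ m ≤ weightedNorm r f :=
  ENNReal.le_tsum m

theorem enorm_coeff_le (hr0 : r ≠ 0) (hr : r ≠ ∞) (f : PowerSeries ℂ) (m : ℕ) :
    ‖PowerSeries.coeff m f‖ₑ ≤ weightedNorm r f * (r ^ m)⁻¹ := by
  rw [← div_eq_mul_inv, ENNReal.le_div_iff_mul_le (Or.inl (pow_ne_zero _ hr0))
    (Or.inl (ENNReal.pow_ne_top hr))]
  exact enorm_coeff_mul_le f m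

/-- The topology is coefficientwise, and the m-th coefficient is at most r^(-m) times the norm. -/
theorem summable_of_weightedNorm (hr0 : r ≠ 0) (hr : r ≠ ∞) {ι : Type*} {f : ι → PowerSeries ℂ}
    {t : ι → ℝ≥0∞} (hf : ∀ i, weightedNorm r (f i) ≤ t i) (h : ∑' i, t i ≠ ∞) : Summable f := by
  rw [PowerSeries.WithPiTopology.summable_iff_summable_coeff]
  intro m
  apply Summable.of_norm
  have h1 : ∑' i, ‖PowerSeries.coeff m (f i)‖ₑ ≠ ∞ := by
    have hrm : (r ^ m)⁻¹ ≠ ∞ := ENNReal.inv_ne_top.2 (pow_ne_zero _ hr0)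
    refine ne_top_of_le_ne_top (ENNReal.mul_ne_top h hrm) ?_
    rw [← ENNReal.tsum_mul_right]
    exact ENNReal.tsum_le_tsum fun i => (enorm_coeff_le hr0 hr _ m).trans
      (mul_le_mul' (hf i) le_rfl)
  simpa using ENNReal.summable_toReal h1

theorem tendsto_zero_of_weightedNorm (hr0 : r ≠ 0) (hr : r ≠ ∞) {f : ℕ → PowerSeries ℂ}
    {t : ℕ → ℝ≥0∞} (hf : ∀ i, weightedNorm r (f i) ≤ t i) (h : Tendsto t atTop (𝓝 0)) :
    Tendsto f atTop (𝓝 0) := by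
  rw [PowerSeries.WithPiTopology.tendsto_iff_coeff_tendsto]
  intro m
  rw [map_zero, tendsto_zero_iff_enorm_tendsto_zero]
  have hrm : (r ^ m)⁻¹ ≠ ∞ := ENNReal.inv_ne_top.2 (pow_ne_zero _ hr0)
  have h1 := ENNReal.Tendsto.mul_const h (Or.inr hrm)
  rw [zero_mul] at h1
  exact tendsto_of_tendsto_of_tendsto_of_le_of_le tendsto_const_nhds h1 (fun _ => zero_le)
    fun i => (enorm_coeff_le hr0 hr _ m).trans (mul_le_mul' (hf i) le_rfl)

/-- The weights `1 / (p - 1 + a - X)` for `p ≥ 1`. -/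
noncomputable def formalWeight (a : ℂ) : ℕ → PowerSeries ℂ
  | 0 => 0
  | p + 1 => PowerSeries.mk fun j => ((p + a)⁻¹) ^ (j + 1)

/-- The weights `1 / n` for `n ≥ 1`, as constant power series. -/
noncomputable def formalHarmonicWeight : ℕ → PowerSeries ℂ
  | 0 => 0
  | n + 1 => PowerSeries.C ((n + 1 : ℕ) : ℂ)⁻¹

theorem formalHarmonicWeight_mul (n : ℕ) : formalHarmonicWeight (n + 1) * (n + 1 : ℕ) = 1 := by
  rw [formalHarmonicWeight, ← map_natCast (PowerSeries.C (R := ℂ)), ← map_mul,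
    inv_mul_cancel₀ (Nat.cast_ne_zero.2 (by omega)), map_one]

theorem weightedNorm_formalHarmonicWeight_le (r : ℝ≥0∞) (n : ℕ) :
    weightedNorm r (formalHarmonicWeight n) ≤ harmonicWeight n := by
  cases n with
  | zero => simp [formalHarmonicWeight, weightedNorm_zero]
  | succ n =>
    rw [formalHarmonicWeight, weightedNorm_C, enorm_inv (Nat.cast_ne_zero.2 (by omega)),
      harmonicWeight, ← ofReal_norm, Complex.norm_natCast, ENNReal.ofReal_natCast]

variable {a : ℂ}

theorem natCast_add_ne_zero (ha : 0 < a.re) (p : ℕ) : (p : ℂ) + a ≠ 0 := by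
  intro h
  have := congrArg Complex.re h
  simp at this
  have : (0 : ℝ) ≤ p := by positivity
  linarith

theorem formalWeight_mul (ha : 0 < a.re) (p : ℕ) :
    formalWeight a (p + 1) * (PowerSeries.C (p + a) - PowerSeries.X) = 1 := by
  have h := natCast_add_ne_zero ha p
  ext m
  rw [mul_sub, map_sub, mul_comm _ (PowerSeries.C _), PowerSeries.coeff_C_mul, formalWeight,
    PowerSeries.coeff_mk, PowerSeries.coeff_one]
  cases m with
  | zero => simp [h]
  | succ m =>
    rw [PowerSeries.coeff_succ_mul_X, PowerSeries.coeff_mk, pow_succ' _ (m + 1),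
      mul_inv_cancel_left₀ h]
    simp

/-- The resolvent identity for the inverses of p + a - X and p + n + a - X. -/
theorem formalWeight_relation (ha : 0 < a.re) (p n : ℕ) :
    formalWeight a (p + 1) = formalWeight a (p + 1 + n) +
      n * formalWeight a (p + 1) * formalWeight a (p + 1 + n) := by
  have h1 := formalWeight_mul ha p
  have h2 := formalWeight_mul ha (p + n)
  rw [show p + n + 1 = p + 1 + n by ring] at h2
  have e : (PowerSeries.C (((p + n : ℕ) : ℂ) + a) : PowerSeries ℂ) = PowerSeries.C ((p : ℂ) + a) + n := by
    simp only [map_add, map_natCast, Nat.cast_add]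
    ring
  rw [e] at h2
  linear_combination formalWeight a (p + 1 + n) * h1 - formalWeight a (p + 1) * h2

/-- With s = 1/(p+b+ρ) the norm is at most the geometric series s/(1 - sρ) = 1/(p+b): the radius ρ
uses up part of Re a and b is what is left. -/
theorem weightedNorm_formalWeight_le {ρ b : ℝ} (hρ : 0 ≤ ρ) (hb : 0 < b) (hab : a.re = ρ + b)
    (p : ℕ) : weightedNorm (ENNReal.ofReal ρ) (formalWeight a p) ≤ majorWeight b p := by
  cases p with
  | zero => simp [formalWeight, weightedNorm_zero]
  | succ p =>
    have hp : (0 : ℝ) ≤ p := by positivity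
    have hc : (p : ℝ) + b + ρ ≤ ‖(p : ℂ) + a‖ := by
      refine le_trans ?_ (Complex.re_le_norm _)
      simp [hab]
      linarith
    set s : ℝ := ((p : ℝ) + b + ρ)⁻¹ with hs
    have hs0 : 0 < s := by positivity
    have hsρ : s * ρ < 1 := by
      rw [hs, inv_mul_lt_iff₀ (by positivity)]
      linarith
    have hle : ‖((p : ℂ) + a)⁻¹‖ₑ ≤ ENNReal.ofReal s := by
      rw [← ofReal_norm, norm_inv]
      apply ENNReal.ofReal_le_ofReal
      rw [hs]
      gcongr
    rw [weightedNorm, majorWeight]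
    calc _ ≤ ∑' m : ℕ, ENNReal.ofReal (s * (s * ρ) ^ m) := by
          refine ENNReal.tsum_le_tsum fun m => ?_
          rw [formalWeight, PowerSeries.coeff_mk, enorm_pow]
          calc _ ≤ ENNReal.ofReal s ^ (m + 1) * ENNReal.ofReal ρ ^ m := by gcongr
            _ = _ := by
              rw [← ENNReal.ofReal_pow hs0.le, ← ENNReal.ofReal_pow hρ,
                ← ENNReal.ofReal_mul (by positivity)]
              congr 1
              ring
      _ = ENNReal.ofReal (s * (1 - s * ρ)⁻¹) := by
          have h := (hasSum_geometric_of_lt_one (by positivity : 0 ≤ s * ρ) hsρ).mul_left s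
          rw [← ENNReal.ofReal_tsum_of_nonneg (fun m => by positivity) h.summable, h.tsum_eq]
      _ = _ := by
          congr 1
          have h1 : (p : ℝ) + b + ρ ≠ 0 := by positivity
          have h2 : (p : ℝ) + b ≠ 0 := by positivity
          have : 1 - s * ρ = ((p : ℝ) + b) * s := by
            rw [hs]
            field_simp
            ring
          rw [this, mul_inv, mul_left_comm, mul_inv_cancel₀ hs0.ne', mul_one]

theorem weightedNorm_connector_le {w : ℕ → PowerSeries ℂ} {W : ℕ → ℝ≥0∞}
    (h : ∀ p, weightedNorm r (w p) ≤ W p) (n p : ℕ) :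
    weightedNorm r (connector w n p) ≤ connector W n p :=
  weightedNorm_mul_le_of_le (weightedNorm_natCast_le r _)
    (weightedNorm_prod_le _ fun _ _ => h _)

theorem weightedNorm_wstep_le {w u : ℕ → PowerSeries ℂ} {W U : ℕ → ℝ≥0∞}
    (h : ∀ p, weightedNorm r (w p) ≤ W p) (hu : ∀ p, weightedNorm r (u p) ≤ U p) (c : Bool)
    (n : ℕ) : weightedNorm r (wstep w c u n) ≤ wstep W c U n := by
  cases c
  · exact weightedNorm_mul_le_of_le (h n)
      ((weightedNorm_sum_le _ _).trans (Finset.sum_le_sum fun _ _ => hu _))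
  · exact weightedNorm_mul_le_of_le (h n) (hu n)

theorem weightedNorm_single_le (r : ℝ≥0∞) (n : ℕ) :
    weightedNorm r (Pi.single (M := fun _ => PowerSeries ℂ) 0 1 n) ≤
      Pi.single (M := fun _ => ℝ≥0∞) 0 1 n := by
  cases n with
  | zero => simp [weightedNorm_one]
  | succ n => simp [weightedNorm_zero]

theorem weightedNorm_wordSum_le {w : ℕ → PowerSeries ℂ} {W : ℕ → ℝ≥0∞}
    (h : ∀ p, weightedNorm r (w p) ≤ W p) (L : List Bool) (n : ℕ) :
    weightedNorm r (wordSum w L n) ≤ wordSum W L n := by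
  induction L generalizing n with
  | nil => exact weightedNorm_single_le r n
  | cons c L ih => exact weightedNorm_wstep_le h ih c n

theorem weightedNorm_connTriple_le {η w u v : ℕ → PowerSeries ℂ} {H W U V : ℕ → ℝ≥0∞}
    (hη : ∀ p, weightedNorm r (η p) ≤ H p) (hw : ∀ p, weightedNorm r (w p) ≤ W p)
    (hu : ∀ p, weightedNorm r (u p) ≤ U p) (hv : ∀ p, weightedNorm r (v p) ≤ V p) (c : Bool)
    (x : (ℕ × ℕ) × ℕ) :
    weightedNorm r (connTriple η w c u v x) ≤ connTriple H W c U V x := by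
  have hc := weightedNorm_connector_le hw
  cases c
  · simp only [connTriple, cond_false]
    split_ifs
    · exact weightedNorm_mul_le_of_le (weightedNorm_mul_le_of_le
        (weightedNorm_mul_le_of_le (hu _) (hη _)) (hc _ _)) (hv _)
    · rw [weightedNorm_zero]
  · simp only [connTriple, cond_true]
    split_ifs
    · exact weightedNorm_mul_le_of_le (weightedNorm_mul_le_of_le
        (weightedNorm_mul_le_of_le (hu _) (hc _ _)) (hw _)) (hv _)
    · rw [weightedNorm_zero]

theorem connectedWeights_formalWeight (ha : 0 < a.re) :
    ConnectedWeights formalHarmonicWeight (formalWeight a) := by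
  -- Re a is split evenly between radius and majorant; only positivity of both halves matters.
  have hb : 0 < a.re / 2 := by positivity
  have hr0 : ENNReal.ofReal (a.re / 2) ≠ 0 := by simpa using ha
  have hr : ENNReal.ofReal (a.re / 2) ≠ ∞ := ENNReal.ofReal_ne_top
  have hw := weightedNorm_formalWeight_le (a := a) hb.le hb (by ring)
  have hη := weightedNorm_formalHarmonicWeight_le (ENNReal.ofReal (a.re / 2))
  have hc := weightedNorm_connector_le hw
  have D := connectedWeights_majorWeight hb
  have hct : ∀ n p, connector (majorWeight (a.re / 2)) n p ≠ ∞ := fun n p => by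
    rw [connector_majorWeight_eq hb]
    exact ENNReal.ofReal_ne_top
  have hηt : ∀ n, harmonicWeight n ≠ ∞ := fun n =>
    ne_top_of_le_ne_top ENNReal.one_ne_top (harmonicWeight_le_one _)
  refine ConnectedWeights.of_tendsto rfl rfl (fun a f s h => h.mul_left a)
    (formalWeight_relation ha) formalHarmonicWeight_mul (fun n q => ?_) (fun m p => ?_)
    (fun n q => ?_) (fun m p => ?_)
  · refine summable_of_weightedNorm hr0 hr
      (fun i => weightedNorm_mul_le_of_le (hc _ _) (hw _)) ?_
    refine ne_top_of_le_ne_top (b := harmonicWeight (n + 1) * connector (majorWeight (a.re / 2)) (n + 1) q)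
      (ENNReal.mul_ne_top (hηt _) (hct _ _)) ?_
    -- The transport relation of the majorant itself evaluates the dominating series.
    rw [← (D.hasSum_right n q).tsum_eq]
    have hinj : Function.Injective (fun i : ℕ => q + i + 1) := fun i j hij => by simpa using hij
    refine le_trans (le_of_eq ?_) (ENNReal.tsum_comp_le_tsum_of_injective hinj _)
    refine tsum_congr fun i => ?_
    rw [if_pos (by omega)]
  · refine summable_of_weightedNorm hr0 hr
      (fun i => weightedNorm_mul_le_of_le (hη _) (hc _ _)) ?_
    refine ne_top_of_le_ne_top (b := connector (majorWeight (a.re / 2)) m (p + 1) * majorWeight (a.re / 2) (p + 1))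
      (ENNReal.mul_ne_top (hct _ _) (majorWeight_ne_top _)) ?_
    rw [← (D.hasSum_left m p).tsum_eq]
    have hinj : Function.Injective (fun i : ℕ => m + i + 1) := fun i j hij => by simpa using hij
    refine le_trans (le_of_eq ?_) (ENNReal.tsum_comp_le_tsum_of_injective hinj _)
    refine tsum_congr fun i => ?_
    rw [if_pos (by omega)]
  · have h := tendsto_zero_of_weightedNorm hr0 hr (hc (n + 1))
      (tendsto_connector_majorWeight_right hb n)
    simpa only [add_comm, mul_zero] using
      ((tendsto_add_atTop_iff_nat q).2 h).const_mul (formalHarmonicWeight (n + 1))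
  · have h := tendsto_zero_of_weightedNorm hr0 hr (fun n => hc n (p + 1))
      (tendsto_connector_majorWeight_left hb p)
    simpa only [add_comm, zero_mul] using
      ((tendsto_add_atTop_iff_nat m).2 h).mul_const (formalWeight a (p + 1))

end Formal

/-! ### Duality for the power series weights. -/

section FormalTransport

open scoped ENNReal PowerSeries.WithPiTopology

variable {a : ℂ}

/-- Finiteness of one majorant double sum bounds the majorant triple series, which makes the formal
triple series summable. -/
theorem hasSum_connTerm_step (ha : 0 < a.re) {c : Bool} {u v : ℕ → PowerSeries ℂ}
    {U V : ℕ → ℝ≥0∞} (hu : ∀ n, weightedNorm (ENNReal.ofReal (a.re / 2)) (u n) ≤ U n)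
    (hv : ∀ n, weightedNorm (ENNReal.ofReal (a.re / 2)) (v n) ≤ V n)
    (hu0 : c = true → u 0 = 0) (hU0 : c = true → U 0 = 0)
    (hv0 : c = false → v 0 = 0) (hV0 : c = false → V 0 = 0)
    (h : ∑' x, connTerm (majorWeight (a.re / 2)) (wstep harmonicWeight c U) V x ≠ ∞) :
    ∃ s, HasSum (connTerm (formalWeight a) (wstep formalHarmonicWeight c u) v) s ∧
      HasSum (connTerm (formalWeight a) u (wstep (formalWeight a) (!c) v)) s := by
  have hb : 0 < a.re / 2 := by positivity
  rw [← (tsum_connTriple hb hU0 hV0).1] at h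
  obtain ⟨s, hs⟩ := summable_of_weightedNorm (by simpa using ha) ENNReal.ofReal_ne_top
    (weightedNorm_connTriple_le
      (weightedNorm_formalHarmonicWeight_le (ENNReal.ofReal (a.re / 2)))
      (weightedNorm_formalWeight_le (a := a) hb.le hb (by ring)) hu hv c) h
  exact ⟨s, hasSum_connTriple (connectedWeights_formalWeight ha) hu0 hv0 hs⟩

theorem hasSum_connTerm_wordSum (ha : 0 < a.re) (L : List Bool) {v : ℕ → PowerSeries ℂ}
    {V : ℕ → ℝ≥0∞} (hv : ∀ n, weightedNorm (ENNReal.ofReal (a.re / 2)) (v n) ≤ V n)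
    (hv0 : v 0 = 0) (hV0 : V 0 = 0)
    (h : ∑' x, connTerm (majorWeight (a.re / 2)) (wordSum harmonicWeight (L ++ [false])) V x ≠ ∞) :
    ∃ s, HasSum (connTerm (formalWeight a) (wordSum formalHarmonicWeight (L ++ [false])) v) s ∧
      HasSum (dualFold (formalWeight a) (L ++ [false]) v) s := by
  have hb : 0 < a.re / 2 := by positivity
  have hη := weightedNorm_formalHarmonicWeight_le (ENNReal.ofReal (a.re / 2))
  have hw := weightedNorm_formalWeight_le (a := a) hb.le hb (by ring)
  induction L generalizing v V with
  | nil =>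
    obtain ⟨s, h1, h2⟩ := hasSum_connTerm_step ha (weightedNorm_single_le _) hv (by simp) (by simp)
      (fun _ => hv0) (fun _ => hV0) h
    exact ⟨s, h1, (hasSum_connTerm_left_single _ _).1 h2⟩
  | cons c L ih =>
    rw [List.cons_append, wordSum_cons] at h
    obtain ⟨s, h1, h2⟩ := hasSum_connTerm_step ha (weightedNorm_wordSum_le hη _) hv
      (fun _ => wordSum_apply_zero rfl (by simp)) (fun _ => wordSum_apply_zero rfl (by simp))
      (fun _ => hv0) (fun _ => hV0) h
    -- The finiteness hypothesis crosses along with the letter.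
    rw [← (tsum_connTriple hb (fun _ => wordSum_apply_zero rfl (by simp)) (fun _ => hV0)).2] at h
    obtain ⟨t, h3, h4⟩ := ih (weightedNorm_wstep_le hw hv (!c)) (wstep_zero rfl _ _)
      (wstep_zero rfl _ _) h
    rw [h3.unique h2] at h4
    exact ⟨s, h1, h4⟩

theorem tsum_wordSum_word_ne_top {b : ℝ} (hb : 0 < b) {k : List ℕ} (hk : k ≠ [])
    (hp : ∀ i ∈ k, 1 ≤ i) :
    ∑' p, wordSum (majorWeight b) (word (plusFirst (hoffmanDual k.reverse))) p ≠ ∞ := by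
  rw [← reverse_map_not_word hk hp, ← dualFold_eq_wordSum, word_eq_innerWord k hk]
  have h := tsum_connTerm_ne_top hb (innerWord k)
  rw [wordSum_cons, ← (tsum_connTriple hb (fun _ => wordSum_apply_zero rfl (by simp)) (by simp)).2,
    tsum_connTerm_wordSum hb _ (wstep_zero rfl _ _)] at h
  exact h

/-- The duality for the formal weights `1 / (p - 1 + a - X)`. -/
theorem exists_hasSum_formal_duality (ha : 0 < a.re) {k : List ℕ} (hk : k ≠ [])
    (hp : ∀ i ∈ k, 1 ≤ i) :
    ∃ s, HasSum (fun n => wordSum formalHarmonicWeight (true :: word k) n *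
        connector (formalWeight a) n 0) s ∧
      HasSum (wordSum (formalWeight a) (word (plusFirst (hoffmanDual k.reverse)))) s := by
  have hb : 0 < a.re / 2 := by positivity
  have hη := weightedNorm_formalHarmonicWeight_le (ENNReal.ofReal (a.re / 2))
  have hw := weightedNorm_formalWeight_le (a := a) hb.le hb (by ring)
  rw [← reverse_map_not_word hk hp, ← dualFold_eq_wordSum, word_eq_innerWord k hk]
  have h := tsum_connTerm_ne_top hb (innerWord k)
  rw [wordSum_cons] at h
  obtain ⟨s, h1, h2⟩ := hasSum_connTerm_step ha (weightedNorm_wordSum_le hη _)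
      (weightedNorm_single_le _) (fun _ => wordSum_apply_zero rfl (by simp))
      (fun _ => wordSum_apply_zero rfl (by simp)) (by simp) (by simp) h
  rw [← (tsum_connTriple hb (fun _ => wordSum_apply_zero rfl (by simp)) (by simp)).2] at h
  obtain ⟨t, h3, h4⟩ := hasSum_connTerm_wordSum ha (innerWord k)
    (weightedNorm_wstep_le hw (weightedNorm_single_le _) false) (wstep_zero rfl _ _)
    (wstep_zero rfl _ _) h
  rw [h3.unique h2] at h4
  exact ⟨s, (hasSum_connTerm_right_single _ _).1 h1, h4⟩

end FormalTransport

/-! ### Extraction of coefficients. -/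

section Coefficients

variable {a : ℂ}

/-- Compare coefficients in f = (p + a - X) · (f w). This one recursion becomes Pascal's rule for
powers of w and the recursion of the star sums for products. -/
theorem coeff_formalWeight_mul_succ (ha : 0 < a.re) (p m : ℕ) (f : PowerSeries ℂ) :
    PowerSeries.coeff (m + 1) (f * formalWeight a (p + 1)) =
      ((p : ℂ) + a)⁻¹ * (PowerSeries.coeff (m + 1) f +
        PowerSeries.coeff m (f * formalWeight a (p + 1))) := by
  have h := natCast_add_ne_zero ha p
  have h1 : f = PowerSeries.C (p + a) * (f * formalWeight a (p + 1)) -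
      f * formalWeight a (p + 1) * PowerSeries.X := by
    linear_combination -f * formalWeight_mul ha p
  have h2 := congrArg (PowerSeries.coeff (m + 1)) h1
  rw [map_sub, PowerSeries.coeff_C_mul, PowerSeries.coeff_succ_mul_X] at h2
  rw [h2]
  field_simp
  ring

theorem coeff_zero_formalWeight_mul (p : ℕ) (f : PowerSeries ℂ) :
    PowerSeries.coeff 0 (f * formalWeight a (p + 1)) =
      ((p : ℂ) + a)⁻¹ * PowerSeries.coeff 0 f := by
  simp only [PowerSeries.coeff_mul, Finset.HasAntidiagonal.antidiagonal_zero, Finset.sum_singleton,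
    formalWeight, PowerSeries.coeff_mk]
  ring

theorem coeff_formalWeight_pow (ha : 0 < a.re) (p k i : ℕ) :
    PowerSeries.coeff i (formalWeight a (p + 1) ^ (k + 1)) =
      ((k + i).choose i : ℂ) * ((p : ℂ) + a)⁻¹ ^ (k + 1 + i) := by
  induction k generalizing i with
  | zero =>
    rw [zero_add, pow_one, formalWeight, PowerSeries.coeff_mk]
    simp [add_comm]
  | succ k ih =>
    induction i with
    | zero =>
      rw [pow_succ, coeff_zero_formalWeight_mul, ih]
      simp [pow_succ]
      ring
    | succ i ih2 =>
      rw [pow_succ, coeff_formalWeight_mul_succ ha, ih, ← pow_succ, ih2,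
        show k + 1 + (i + 1) = (k + 1 + i) + 1 by ring, Nat.choose_succ_succ,
        show k + (i + 1) = k + 1 + i by ring]
      push_cast
      ring

/-- The product generates the complete homogeneous symmetric polynomials in the 1/(i + a), and these
are the star sums of `{1}_m`. -/
theorem coeff_prod_formalWeight (ha : 0 < a.re) (n m : ℕ) :
    PowerSeries.coeff m (∏ i ∈ Finset.range n, formalWeight a (0 + 1 + i)) =
      (∏ i ∈ Finset.range n, ((i : ℂ) + a)⁻¹) * hurwitzMHSS n (List.replicate m 1) a := by
  induction n generalizing m with
  | zero => cases m <;> simp [hurwitzMHSS, List.replicate_succ, PowerSeries.coeff_one]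
  | succ n ih =>
    rw [Finset.prod_range_succ, Finset.prod_range_succ, show 0 + 1 + n = n + 1 by ring]
    induction m with
    | zero =>
      rw [coeff_zero_formalWeight_mul, ih]
      simp [hurwitzMHSS]
      ring
    | succ m ih2 =>
      rw [coeff_formalWeight_mul_succ ha, ih, ih2, List.replicate_succ, hurwitzMHSS, hurwitzMHSS,
        Finset.sum_Icc_succ_top (by omega),
        show ((n + 1 : ℕ) : ℂ) + a - 1 = n + a by push_cast; ring]
      ring

theorem prod_mul_Gamma (ha : 0 < a.re) (n : ℕ) :
    Complex.Gamma (n + a) = (∏ i ∈ Finset.range n, ((i : ℂ) + a)) * Complex.Gamma a := by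
  induction n with
  | zero => simp
  | succ n ih =>
    rw [Finset.prod_range_succ, Nat.cast_succ, add_right_comm,
      Complex.Gamma_add_one _ (natCast_add_ne_zero ha n), ih]
    ring

theorem gammaBinom_sub {α : ℂ} (hα : α.re < 1) (n : ℕ) :
    gammaBinom ((n : ℂ) - α) n =
      (∏ i ∈ Finset.range n, ((i : ℂ) + (1 - α))) / (n.factorial : ℂ) := by
  have ha : 0 < (1 - α).re := by simpa using hα
  have hG : Complex.Gamma (1 - α) ≠ 0 := Complex.Gamma_ne_zero_of_re_pos ha
  have hf : (n.factorial : ℂ) ≠ 0 := by exact_mod_cast n.factorial_ne_zero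
  rw [gammaBinom, Complex.Gamma_nat_eq_factorial, show (n : ℂ) - α + 1 = n + (1 - α) by ring,
    prod_mul_Gamma ha, show (n : ℂ) - α - n + 1 = 1 - α by ring]
  field_simp

theorem weightedMHS_formalHarmonicWeight (n : ℕ) (ks : List ℕ) :
    weightedMHS formalHarmonicWeight n ks = PowerSeries.C (mhs n ks : ℂ) := by
  induction ks generalizing n with
  | nil => simp [weightedMHS, mhs]
  | cons k ks ih =>
    rw [weightedMHS, mhs, Rat.cast_sum, map_sum]
    refine Finset.sum_congr rfl fun m hm => ?_
    obtain ⟨m, rfl⟩ := Nat.exists_eq_add_of_le' (Finset.mem_Icc.1 hm).1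
    rw [ih, formalHarmonicWeight, ← map_pow, ← map_mul]
    simp

theorem coeff_left_term {α : ℂ} (hα : α.re < 1) {k₁ : ℕ} {ks : List ℕ}
    (hk : ∀ i ∈ k₁ :: ks, 1 ≤ i) (m n : ℕ) :
    PowerSeries.coeff m (wordSum formalHarmonicWeight (true :: word (k₁ :: ks)) (n + 1) *
        connector (formalWeight (1 - α)) (n + 1) 0) =
      (mhs n ks : ℂ) * hurwitzMHSS (n + 1) (List.replicate m 1) (1 - α) /
          (((n + 1 : ℕ) : ℂ) ^ (k₁ + 1) *
            gammaBinom (((n + 1 : ℕ) : ℂ) - α) ((n + 1 : ℕ) : ℂ)) := by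
  have ha : 0 < (1 - α).re := by simpa using hα
  rw [wordSum_cons, wstep_true, wordSum_word_cons_succ rfl hk, weightedMHS_formalHarmonicWeight,
    formalHarmonicWeight, connector, ← map_natCast (PowerSeries.C (R := ℂ)), ← mul_assoc,
    ← map_pow, ← map_mul, ← map_mul, ← map_mul, PowerSeries.coeff_C_mul,
    coeff_prod_formalWeight ha, gammaBinom_sub hα, Finset.prod_inv_distrib]
  have hP : ∏ i ∈ Finset.range (n + 1), ((i : ℂ) + (1 - α)) ≠ 0 :=
    Finset.prod_ne_zero_iff.2 fun i _ => natCast_add_ne_zero ha i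
  have hf : ((n + 1).factorial : ℂ) ≠ 0 := by exact_mod_cast (n + 1).factorial_ne_zero
  have hn : ((n + 1 : ℕ) : ℂ) ≠ 0 := Nat.cast_ne_zero.2 (by omega)
  generalize ((n + 1 : ℕ) : ℂ) = N at *
  rw [inv_pow]
  field_simp
  ring

theorem sum_antidiagonalTuple_succ {M : Type*} [AddCommMonoid M] (d m : ℕ)
    (f : (Fin (d + 1) → ℕ) → M) :
    ∑ j ∈ Finset.Nat.antidiagonalTuple (d + 1) m, f j =
      ∑ x ∈ Finset.HasAntidiagonal.antidiagonal m,
        ∑ j ∈ Finset.Nat.antidiagonalTuple d x.2, f (Fin.cons x.1 j) := by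
  rw [Finset.sum_sigma']
  refine Finset.sum_bij' (fun j _ => ⟨(j 0, ∑ i, Fin.tail j i), Fin.tail j⟩)
    (fun x _ => Fin.cons x.1.1 x.2) ?_ ?_ ?_ ?_ ?_
  · intro j hj
    rw [Finset.Nat.mem_antidiagonalTuple, Fin.sum_univ_succ] at hj
    simp only [Finset.mem_sigma, Finset.HasAntidiagonal.mem_antidiagonal,
      Finset.Nat.mem_antidiagonalTuple, and_true]
    exact hj
  · rintro ⟨⟨i, i'⟩, j⟩ hj
    simp only [Finset.mem_sigma, Finset.HasAntidiagonal.mem_antidiagonal,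
      Finset.Nat.mem_antidiagonalTuple] at hj
    rw [Finset.Nat.mem_antidiagonalTuple, Fin.sum_univ_succ]
    simp [hj.2, hj.1]
  · intro j _
    simp
  · rintro ⟨⟨i, i'⟩, j⟩ hj
    simp only [Finset.mem_sigma, Finset.HasAntidiagonal.mem_antidiagonal,
      Finset.Nat.mem_antidiagonalTuple] at hj
    obtain ⟨-, rfl⟩ := hj
    simp
  · intro j _
    simp

theorem coeff_weightedMHS_formalWeight (ha : 0 < a.re) (K : List ℕ) (hK : ∀ i ∈ K, 1 ≤ i)
    (m N : ℕ) :
    PowerSeries.coeff m (weightedMHS (formalWeight a) N K) =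
      ∑ j ∈ Finset.Nat.antidiagonalTuple K.length m,
        (prodBinom K (List.ofFn j) : ℂ) * hurwitzMHS N (addEntries K (List.ofFn j)) a := by
  induction K generalizing m N with
  | nil =>
    cases m <;> simp [weightedMHS, prodBinom, addEntries, hurwitzMHS, PowerSeries.coeff_one]
  | cons k K ih =>
    rw [List.length_cons, sum_antidiagonalTuple_succ, weightedMHS, map_sum]
    simp only [List.ofFn_succ, Fin.cons_zero, Fin.cons_succ, prodBinom, addEntries,
      List.zipWith_cons_cons, List.prod_cons, hurwitzMHS, Finset.mul_sum]
    simp only [Finset.sum_comm (t := Finset.Icc 1 N)]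
    refine Finset.sum_congr rfl fun p hp => ?_
    obtain ⟨p, rfl⟩ := Nat.exists_eq_add_of_le' (Finset.mem_Icc.1 hp).1
    obtain ⟨k, rfl⟩ := Nat.exists_eq_add_of_le' (hK k (by simp))
    rw [PowerSeries.coeff_mul]
    refine Finset.sum_congr rfl fun x _ => ?_
    rw [coeff_formalWeight_pow ha, ih (fun i hi => hK i (by simp [hi])), Finset.mul_sum]
    refine Finset.sum_congr rfl fun j _ => ?_
    rw [show ((p + 1 : ℕ) : ℂ) + a - 1 = p + a by push_cast; ring,
      show k + 1 + x.1 - 1 = k + x.1 by omega, inv_pow, one_div, prodBinom, addEntries]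
    push_cast
    ring

end Coefficients

/-! ### Convergence of the Hurwitz multiple zeta values. -/

section Convergence

open scoped ENNReal

variable {a : ℂ}

theorem enorm_inv_le_majorWeight (ha : 0 < a.re) (p : ℕ) :
    ‖((p : ℂ) + a)⁻¹‖ₑ ≤ majorWeight a.re (p + 1) := by
  rw [← ofReal_norm, norm_inv, majorWeight]
  apply ENNReal.ofReal_le_ofReal
  have : (p : ℝ) + a.re ≤ ‖(p : ℂ) + a‖ := by
    refine le_trans (le_of_eq ?_) (Complex.re_le_norm _)
    simp
  gcongr

theorem enorm_hurwitz_factor_le (ha : 0 < a.re) (p k j : ℕ) :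
    ‖(1 / (((p + 1 : ℕ) : ℂ) + a - 1) ^ (k + j) : ℂ)‖ₑ ≤
      ENNReal.ofReal a.re⁻¹ ^ j * majorWeight a.re (p + 1) ^ k := by
  rw [show ((p + 1 : ℕ) : ℂ) + a - 1 = p + a by push_cast; ring, one_div, ← inv_pow, enorm_pow,
    pow_add, mul_comm]
  have h := enorm_inv_le_majorWeight ha p
  gcongr
  exact h.trans (majorWeight_le ha _)

/-- Raising the exponents by j costs only a constant factor, so convergence for K alone serves every
K + j. -/
theorem enorm_hurwitzMHS_le (ha : 0 < a.re) (K : List ℕ) (j : List ℕ) (hj : K.length = j.length)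
    (n : ℕ) : ‖hurwitzMHS n (addEntries K j) a‖ₑ ≤
      ENNReal.ofReal a.re⁻¹ ^ j.sum * weightedMHS (majorWeight a.re) n K := by
  induction K generalizing j n with
  | nil =>
    cases j with
    | nil => simp [addEntries, hurwitzMHS, weightedMHS]
    | cons i j => simp at hj
  | cons k K ih =>
    cases j with
    | nil => simp at hj
    | cons i j =>
      have hj' : K.length = j.length := by simpa using hj
      rw [addEntries, List.zipWith_cons_cons, hurwitzMHS, weightedMHS, Finset.mul_sum]
      refine (enorm_sum_le _ _).trans (Finset.sum_le_sum fun p hp => ?_)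
      obtain ⟨p, rfl⟩ := Nat.exists_eq_add_of_le' (Finset.mem_Icc.1 hp).1
      rw [enorm_mul, List.sum_cons, pow_add (ENNReal.ofReal _)]
      refine (mul_le_mul' (enorm_hurwitz_factor_le ha p k i) (ih j hj' _)).trans (le_of_eq ?_)
      ring

theorem tendsto_hurwitzMHS (ha : 0 < a.re) (K : List ℕ) (hK0 : K ≠ []) (hK : ∀ i ∈ K, 1 ≤ i)
    (hsum : ∑' p, wordSum (majorWeight a.re) (word K) p ≠ ∞) (j : List ℕ)
    (hj : K.length = j.length) :
    Tendsto (fun n : ℕ => hurwitzMHS n (addEntries K j) a) atTop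
      (𝓝 (hurwitzMZV (addEntries K j) a)) := by
  -- `hurwitzMZV` is a `limUnder`, which is the true limit as soon as some limit exists.
  suffices h : ∃ l, Tendsto (fun n : ℕ => hurwitzMHS n (addEntries K j) a) atTop (𝓝 l) by
    obtain ⟨l, hl⟩ := h
    rwa [hurwitzMZV, hl.limUnder_eq]
  cases K with
  | nil => exact absurd rfl hK0
  | cons k K =>
  cases j with
  | nil => simp at hj
  | cons i j =>
    have hj' : K.length = j.length := by simpa using hj
    have hs : Summable fun p : ℕ => 1 / (((p + 1 : ℕ) : ℂ) + a - 1) ^ (k + i) *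
        hurwitzMHS p (addEntries K j) a := by
      apply Summable.of_norm
      have h1 : ∑' p : ℕ, ‖1 / (((p + 1 : ℕ) : ℂ) + a - 1) ^ (k + i) *
          hurwitzMHS p (addEntries K j) a‖ₑ ≠ ∞ := by
        refine ne_top_of_le_ne_top (b := ENNReal.ofReal a.re⁻¹ ^ (i + j.sum) *
          ∑' p, wordSum (majorWeight a.re) (word (k :: K)) p)
          (ENNReal.mul_ne_top (by finiteness) hsum) ?_
        rw [← ENNReal.tsum_mul_left]
        refine le_trans (ENNReal.tsum_le_tsum fun p => ?_)
          (ENNReal.tsum_comp_le_tsum_of_injective (add_left_injective 1) _)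
        rw [wordSum_word_cons_succ rfl hK, enorm_mul, pow_add (ENNReal.ofReal _)]
        refine (mul_le_mul' (enorm_hurwitz_factor_le ha p k i)
          (enorm_hurwitzMHS_le ha K j hj' _)).trans (le_of_eq ?_)
        ring
      simpa using ENNReal.summable_toReal h1
    refine ⟨_, hs.hasSum.tendsto_sum_nat.congr fun n => ?_⟩
    rw [show addEntries (k :: K) (i :: j) = (k + i) :: addEntries K j from rfl, hurwitzMHS,
      show Finset.Icc 1 n = Finset.Ico 1 (n + 1) by ext; simp, Finset.sum_Ico_eq_sum_range]
    refine Finset.sum_congr rfl fun p _ => ?_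
    rw [add_comm 1 p]
    rfl

end Convergence

/-! ### The theorem, as the m-th coefficient of the formal duality. -/

open scoped PowerSeries.WithPiTopology in
theorem mainTheorem2 (m k₁ : ℕ) (ks : List ℕ) (hk : ∀ i ∈ k₁ :: ks, 1 ≤ i)
    (α : ℂ) (hα : α.re < 1) :
    let K : List ℕ := plusFirst (hoffmanDual (k₁ :: ks).reverse)
    let d : ℕ := (k₁ :: ks).sum + 1 - (k₁ :: ks).length
    (∀ j ∈ Finset.Nat.antidiagonalTuple d m,
      Tendsto (fun n : ℕ => hurwitzMHS n (addEntries K (List.ofFn j)) (1 - α)) atTop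
        (𝓝 (hurwitzMZV (addEntries K (List.ofFn j)) (1 - α)))) ∧
    HasSum
      (fun n : ℕ =>
        (mhs n ks : ℂ) * hurwitzMHSS (n + 1) (List.replicate m 1) (1 - α) /
          (((n + 1 : ℕ) : ℂ) ^ (k₁ + 1) *
            gammaBinom (((n + 1 : ℕ) : ℂ) - α) ((n + 1 : ℕ) : ℂ)))
      (∑ j ∈ Finset.Nat.antidiagonalTuple d m,
        (prodBinom K (List.ofFn j) : ℂ) *
          hurwitzMZV (addEntries K (List.ofFn j)) (1 - α)) := by
  intro K d
  have ha : 0 < (1 - α).re := by simpa using hα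
  have hr0 : (k₁ :: ks).reverse ≠ [] := by simp
  have hr : ∀ i ∈ (k₁ :: ks).reverse, 1 ≤ i := fun i hi => hk i (List.mem_reverse.1 hi)
  have hne := hoffmanDual_ne_nil _ hr0 hr
  have hd : d = K.length := by
    have := hoffmanDual_length _ hr0 hr
    rw [List.length_reverse, List.sum_reverse] at this
    simp only [K, d, plusFirst_length]
    omega
  have hKpos : ∀ i ∈ K, 1 ≤ i := by
    intro i hi
    have hpos := hoffmanDual_pos (k₁ :: ks).reverse
    simp only [K] at hi
    generalize hoffmanDual (k₁ :: ks).reverse = D at *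
    cases D with
    | nil => exact absurd rfl hne
    | cons x D =>
      rw [plusFirst, List.mem_cons] at hi
      rcases hi with rfl | hi
      · omega
      · exact hpos i (by simp [hi])
  have hK0 : K ≠ [] := by
    rw [← List.length_pos_iff, plusFirst_length, List.length_pos_iff]
    exact hne
  obtain ⟨s, hL, hR⟩ := exists_hasSum_formal_duality ha (by simp) hk
  have hfin := tsum_wordSum_word_ne_top ha (by simp) hk
  change HasSum (wordSum _ (word K)) s at hR
  change ∑' p, wordSum _ (word K) p ≠ _ at hfin
  clear_value d
  subst hd
  have hconv : ∀ j ∈ Finset.Nat.antidiagonalTuple K.length m,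
      Tendsto (fun n : ℕ => hurwitzMHS n (addEntries K (List.ofFn j)) (1 - α)) atTop
        (𝓝 (hurwitzMZV (addEntries K (List.ofFn j)) (1 - α))) := fun j _ =>
    tendsto_hurwitzMHS ha K hK0 hKpos hfin _ (by simp)
  refine ⟨hconv, ?_⟩
  have hlim : PowerSeries.coeff m s = ∑ j ∈ Finset.Nat.antidiagonalTuple K.length m,
      (prodBinom K (List.ofFn j) : ℂ) * hurwitzMZV (addEntries K (List.ofFn j)) (1 - α) := by
    -- The shift by 1 turns partial sums over `range (n + 1)` into truncated sums with outer index
    -- at most n.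
    have h1 := (PowerSeries.WithPiTopology.tendsto_iff_coeff_tendsto _ _ _ _).1
      ((tendsto_add_atTop_iff_nat 1).2 hR.tendsto_sum_nat) m
    simp only [sum_wordSum_word (w := formalWeight (1 - α)) rfl K hKpos,
      coeff_weightedMHS_formalWeight ha K hKpos] at h1
    exact tendsto_nhds_unique h1 (tendsto_finsetSum _ fun j hj => (hconv j hj).const_mul _)
  rw [← hlim]
  have h2 := (PowerSeries.WithPiTopology.hasSum_iff_hasSum_coeff _).1 hL m
  -- The term at n = 0 vanishes because the harmonic weight there is 0, so the series may start at
  -- 1.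
  have h3 := (hasSum_nat_add_iff' 1).2 h2
  rw [Finset.sum_range_one, wordSum_cons, wstep_zero rfl, zero_mul, map_zero, sub_zero] at h3
  exact funext (coeff_left_term hα hk m) ▸ h3
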